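/- **Proposition (Holley–Stroock principle).** Let $d\in\{1,2\}$, $q\in\mathbb N$, $\Omega_0=\{1,\dots,q\}$ and $\Omega=\Omega_0^{\mathbb Z^d}$ with the product topology and its Borel $\sigma$-algebra $\mathcal F$. For $\eta\in\Omega$ let $\eta^{x,i}$ be the configuration equal to $\eta$ off $x$ and to $i$ at $x$; for $\Lambda\Subset\mathbb Z^d$ (finite) let $[\eta_\Lambda]=\{\omega:\omega_\Lambda=\eta_\Lambda\}$, write $\nu(\eta_\Lambda)=\nu([\eta_\Lambda])$ for a measure $\nu$ on $\Omega$, and for $f:\Omega\to\mathbb R$ let $\delta_yf=\sup_{\eta,i}|f(\eta^{y,i})-f(\eta)|$. *Dynamics.* Let $c_x(\eta,i)$ $(x\in\mathbb Z^d,\ i\in\Omega_0,\ \eta\in\Omega)$ be single-site rates such that * (R1) $\sup_x\sum_i\|c_x(\cdot,i)\|_\infty<\infty$; * (R2) each $\eta\mapsto c_x(\eta,i)$ is continuous; * (R3) $\inf_{x,\eta,i}c_x(\eta,i)>0$; * (R4) $\sum_{y\in\mathbb Z^d}|y|\,\sup_x\delta_{x+y}\bigl(c_x(\cdot,i)\mathbf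 1\{\eta_x\ne i\}\bigr)<\infty$ for every $i\in\Omega_0$. Let $(P_t)_{t\ge0}$ be the Markov semigroup on $C(\Omega)$ of the interacting particle system with these rates, that is, the one whose generator is the closure of $$\mathscr Lf(\eta)=\sum_x\sum_i c_x(\eta,i)\,[f(\eta^{x,i})-f(\eta)],\qquad f\in D(\Omega)=\Bigl\{f\in C(\Omega):\sum_x\delta_xf<\infty\Bigr\},$$ and write $\nu_t=\nu P_t$. A probability measure $\mu$ is reversible if $\int f\,P_tg\,d\mu=\int g\,P_tf\,d\mu$ for all $t\ge 0$ and $f,g\in C(\Omega)$. *Specification.* Let $\gamma=(\gamma_\Lambda)_{\Lambda\Subset\mathbb Z^d}$ be a specification: $\gamma_\Lambda$ is a proper probability kernel from $(\Omega,\mathcal F_{\Lambda^c})$ to $(\Omega,\mathcal F)$, and $\gamma_\Lambda\gamma_\Delta=\gamma_\Lambda$ for $\Delta\subset\Lambda$. Let $\mathscr G(\gamma)$ be the set of probability measures $\mu$ on $\Omega$ with $\mu\gamma_\Lambda=\mu$ for all $\Lambda\Subset\mathbb Z^d$. Write $\gamma_x=\gamma_{\{x\}}$ and $\gamma_\Lambda(\eta_\Lambda|\omega_{\Lambda^c})=\gamma_\Lambda([\eta_\Lambda]\,|\,\omega)$.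 Assume * (S1) for every $\Lambda\Subset\mathbb Z^d$: $\lim_{\Delta\uparrow\mathbb Z^d}\sup_{\eta,\xi}|\gamma_\Lambda(\eta_\Lambda|\eta_{\Delta\setminus\Lambda}\xi_{\Delta^c})-\gamma_\Lambda(\eta_\Lambda|\eta_{\Lambda^c})|=0$; * (S2) $\inf_\eta\gamma_0(\eta_0|\eta_{0^c})>0$; * (S3) $\sum_{y\in\mathbb Z^d}|y|\,\sup_x\delta_{x+y}\gamma_x<\infty$, where for $y\neq x$ one sets $\delta_y\gamma_x=\sup_{\omega,i}|\gamma_x(\omega_x|\omega^{y,i}_{x^c})-\gamma_x(\omega_x|\omega_{x^c})|$. *Entropy.* For probability measures $\nu,\mu$ on $\Omega$ and $\Lambda\Subset\mathbb Z^d$ let $h_\Lambda(\nu|\mu)=\sum_{\sigma\in\Omega_0^\Lambda}\nu(\sigma)\log\frac{\nu(\sigma)}{\mu(\sigma)}$ if $\nu\ll\mu$ on $\mathcal F_\Lambda$, and $h_\Lambda(\nu|\mu)=\infty$ otherwise, with $0\log 0=0$; let $g_\Lambda(\nu|\mu)=\frac{d}{dt}\big|_{t=0}h_\Lambda(\nu_t|\mu)$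 (right derivative). Suppose that there is a reversible measure $\mu$ with $\mu\in\mathscr G(\gamma)$. If a probability measure $\nu$ on $\Omega$ satisfies * (M1) $\nu(\eta_\Lambda)>0$ for all $\eta\in\Omega$ and $\Lambda\Subset\mathbb Z^d$, and * (M2) $g_\Lambda(\nu|\mu)=0$ for all $\Lambda\Subset\mathbb Z^d$, then $\nu\in\mathscr G(\gamma)$. -/

import Mathlib

open MeasureTheory ProbabilityTheory Filter Topology
open scoped ENNReal NNReal

noncomputable section

namespace IPS

/-! ### Configurations -/

/-- The lattice `ℤ^d`. -/
abbrev Site (d : ℕ) : Type := Fin d → ℤ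

/-- The configuration space `Ω = {1,…,q}^{ℤ^d}`, with the product topology and its Borel
σ-algebra (both are the product instances of Mathlib). -/
abbrev Config (d q : ℕ) : Type := Site d → Fin q

variable {d q : ℕ}

/-- The cylinder set `[σ] = {ω : ω_Λ = σ}` of a pattern `σ ∈ Ω_Λ`; the cylinder set `[η_Λ]` of a
configuration `η ∈ Ω` is `cyl Λ (Λ.restrict η)`. -/
def cyl (Λ : Finset (Site d)) (σ : Λ → Fin q) : Set (Config d q) :=
  {ω | ∀ x : Λ, ω x = σ x}

/-- The configuration `η_Δ ξ_{Δᶜ}`. -/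
def glue (Δ : Finset (Site d)) (η ξ : Config d q) : Config d q :=
  fun x => if x ∈ Δ then η x else ξ x

/-- The oscillation `δ_y f = sup_{η, i} |f(η^{y,i}) - f(η)|` of `f` at the site `y`, as an
extended nonnegative number; `Function.update η y i` is `η^{y,i}`. -/
def osc (y : Site d) (f : Config d q → ℝ) : ℝ≥0∞ :=
  ⨆ (η : Config d q) (i : Fin q), ‖f (Function.update η y i) - f η‖ₑ

/-! ### Specifications and Gibbs measures -/

/-- A specification: for every finite `Λ` a proper probability kernel `γ_Λ` from
`(Ω, 𝓕_{Λᶜ})` to `(Ω, 𝓕)`, with the consistency relation `γ_Λ γ_Δ = γ_Λ` for `Δ ⊆ Λ`. -/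
structure Specification (d q : ℕ) where
  kernel (Λ : Finset (Site d)) :
    Kernel[cylinderEvents (X := fun _ : Site d => Fin q) ((Λ : Set (Site d))ᶜ),
      MeasurableSpace.pi] (Config d q) (Config d q)
  isProbabilityMeasure (Λ : Finset (Site d)) (ω : Config d q) :
    IsProbabilityMeasure (kernel Λ ω)
  isProper (Λ : Finset (Site d)) : (kernel Λ).IsProper
  consistent (Δ Λ : Finset (Site d)) (_ : Δ ⊆ Λ) (ω : Config d q) (A : Set (Config d q))
    (_ : MeasurableSet A) :
    ∫⁻ ξ, kernel Δ ξ A ∂(kernel Λ ω) = kernel Λ ω A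

namespace Specification

variable (γ : Specification d q)

/-- `γ_Λ(η_Λ | ω_{Λᶜ})`: the `γ_Λ`-probability of the cylinder set `[η_Λ]` with boundary
condition `ω`. -/
def condProb (Λ : Finset (Site d)) (η ω : Config d q) : ℝ :=
  (γ.kernel Λ ω).real (cyl Λ (Λ.restrict η))

/-- The set `𝓖(γ)` of Gibbs measures: probability measures that satisfy the DLR equations
`μ γ_Λ = μ` for all finite `Λ`. -/
def gibbsMeasures : Set (Measure (Config d q)) :=
  {μ | IsProbabilityMeasure μ ∧ ∀ (Λ : Finset (Site d)) (A : Set (Config d q)),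
    MeasurableSet A → ∫⁻ ω, γ.kernel Λ ω A ∂μ = μ A}

/-- Quasilocality:
`lim_{Δ ↑ ℤ^d} sup_{η,ξ} |γ_Λ(η_Λ | η_{Δ∖Λ} ξ_{Δᶜ}) - γ_Λ(η_Λ | η_{Λᶜ})| = 0` for all finite `Λ`. -/
def IsQuasilocal : Prop :=
  ∀ Λ : Finset (Site d),
    Tendsto (fun Δ : Finset (Site d) =>
        ⨆ (η : Config d q) (ξ : Config d q), ‖γ.condProb Λ η (glue Δ η ξ) - γ.condProb Λ η η‖ₑ)
      atTop (𝓝 0)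

/-- Non-nullness: `inf_η γ_0(η_0 | η_{0ᶜ}) ≥ δ` for some `δ > 0`. -/
def IsNonNull : Prop :=
  ∃ δ : ℝ, 0 < δ ∧ ∀ η : Config d q, δ ≤ γ.condProb {0} η η

/-- `δ_y γ_x(·) = sup_{ω,i} |γ_x(ω_x | ω_{xᶜ}^{y,i}) - γ_x(ω_x | ω_{xᶜ})|`, for `y ≠ x`. -/
def oscSite (y x : Site d) : ℝ≥0∞ :=
  ⨆ (ω : Config d q) (i : Fin q),
    ‖γ.condProb {x} ω (Function.update ω y i) - γ.condProb {x} ω ω‖ₑ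

/-- `∑_y |y| sup_x δ_{x+y} γ_x(·) < ∞`. -/
def HasSummableInfluence : Prop :=
  ∑' y : Site d, ‖y‖ₑ * ⨆ x : Site d, γ.oscSite (x + y) x < ∞

end Specification

/-! ### Transition rates -/

/-- A family of single-site rates: `c x η i` is the rate `c_x(η, i)` at which the spin at `x`
switches to `i` when the configuration is `η`. -/
abbrev Rates (d q : ℕ) : Type := Site d → Config d q → Fin q → ℝ

namespace Rates

variable (c : Rates d q)

/-- `sup_x ∑_i ‖c_x(·, i)‖_∞ < ∞`. -/
def IsUniformlyBounded : Prop :=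
  ⨆ x : Site d, ∑ i : Fin q, ⨆ η : Config d q, ‖c x η i‖ₑ < ∞

/-- Every `c_x(·, i)` is continuous. -/
def IsContinuous : Prop :=
  ∀ (x : Site d) (i : Fin q), Continuous fun η => c x η i

/-- `inf_{x, η, i} c_x(η, i) > 0`. -/
def IsBoundedBelow : Prop :=
  ∃ δ : ℝ, 0 < δ ∧ ∀ (x : Site d) (η : Config d q) (i : Fin q), δ ≤ c x η i

/-- The rate `c_x(η, i) 1{i ≠ η_x}` of an actual change of the spin at `x` to `i`. -/
def flip (x : Site d) (i : Fin q) (η : Config d q) : ℝ :=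
  if i = η x then 0 else c x η i

/-- `∑_y |y| sup_x δ_{x+y} c_x(·, i) < ∞` for every `i`, where only rates of actual changes
(`i ≠ η_x`) are counted. -/
def HasSummableInfluence : Prop :=
  ∀ i : Fin q, ∑' y : Site d, ‖y‖ₑ * ⨆ x : Site d, osc (x + y) (c.flip x i) < ∞

/-- The graph of the operator `𝓛`,
`𝓛 f(η) = ∑_x ∑_i c_x(η, i) [f(η^{x,i}) - f(η)]`,
on the space `D(Ω) = {f ∈ C(Ω) : ∑_x δ_x f < ∞}`. -/
def preGenerator : Set (C(Config d q, ℝ) × C(Config d q, ℝ)) :=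
  {p | ∑' x : Site d, osc x p.1 < ∞ ∧
    ∀ η : Config d q, HasSum
      (fun x : Site d => ∑ i : Fin q, c x η i * (p.1 (Function.update η x i) - p.1 η)) (p.2 η)}

end Rates

/-! ### Markov semigroups -/

/-- A Markov (Feller) semigroup on `C(Ω)`, given through its transition kernels
`P_t(η, dξ)`. -/
structure MarkovSemigroup (d q : ℕ) where
  kernel : ℝ≥0 → Kernel (Config d q) (Config d q)
  isMarkovKernel (t : ℝ≥0) : IsMarkovKernel (kernel t)
  kernel_zero : kernel 0 = Kernel.id
  kernel_add (s t : ℝ≥0) : kernel (s + t) = kernel t ∘ₖ kernel s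
  feller (t : ℝ≥0) (f : C(Config d q, ℝ)) : Continuous fun η => ∫ ξ, f ξ ∂(kernel t η)
  strongly_continuous (f : C(Config d q, ℝ)) :
    Tendsto (fun t : ℝ≥0 =>
      (⟨fun η => ∫ ξ, f ξ ∂(kernel t η), feller t f⟩ : C(Config d q, ℝ))) (𝓝 0) (𝓝 f)

namespace MarkovSemigroup

variable (P : MarkovSemigroup d q)

/-- `P_t f ∈ C(Ω)`, where `(P_t f)(η) = ∫ f(ξ) P_t(η, dξ)`. -/
def op (t : ℝ≥0) (f : C(Config d q, ℝ)) : C(Config d q, ℝ) :=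
  ⟨fun η => ∫ ξ, f ξ ∂(P.kernel t η), P.feller t f⟩

/-- The time-evolved measure `ν_t = ν P_t`. -/
def evolve (ν : Measure (Config d q)) (t : ℝ≥0) : Measure (Config d q) :=
  ν.bind (P.kernel t)

/-- The graph of the (infinitesimal) generator of the semigroup: the pairs `(f, g)` with
`(P_t f - f) / t → g` uniformly as `t ↓ 0`. -/
def generator : Set (C(Config d q, ℝ) × C(Config d q, ℝ)) :=
  {p | Tendsto (fun t : ℝ≥0 => (t : ℝ)⁻¹ • (P.op t p.1 - p.1)) (𝓝[>] 0) (𝓝 p.2)}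

/-- The semigroup is the one of the interacting particle system with rates `c`: its generator is
the closure of the operator `𝓛` on `D(Ω)`, that is, it extends `𝓛` and `D(Ω)` is a core. -/
def IsGeneratedBy (c : Rates d q) : Prop :=
  P.generator = closure c.preGenerator

/-- `μ` is reversible: `∫ f P_t g dμ = ∫ g P_t f dμ` for all `t ≥ 0` and `f, g ∈ C(Ω)`. -/
def IsReversible (μ : Measure (Config d q)) : Prop :=
  ∀ (t : ℝ≥0) (f g : C(Config d q, ℝ)),
    ∫ η, f η * P.op t g η ∂μ = ∫ η, g η * P.op t f η ∂μ

end MarkovSemigroup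

/-! ### Relative entropy and its loss -/

open scoped Classical in
/-- The relative entropy `h_Λ(ν | μ) = ∑_{σ ∈ Ω_Λ} ν(σ) log (ν(σ) / μ(σ))` in the finite volume
`Λ`, which is `∞` unless `ν ≪ μ` on `𝓕_Λ`. -/
def relEntropy (Λ : Finset (Site d)) (ν μ : Measure (Config d q)) : EReal :=
  if ∀ σ : Λ → Fin q, μ (cyl Λ σ) = 0 → ν (cyl Λ σ) = 0 then
    ((∑ σ : Λ → Fin q,
      ν.real (cyl Λ σ) * Real.log (ν.real (cyl Λ σ) / μ.real (cyl Λ σ)) : ℝ) : EReal)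
  else ⊤

/-- The assertion that the finite-volume relative entropy loss
`g_Λ(ν | μ) = d/dt|_{t=0} h_Λ(ν_t | μ)` (a right derivative, since `t ≥ 0`) exists and has the
value `g`; the entropy has to be finite for small times. -/
def HasEntropyLoss (P : MarkovSemigroup d q) (Λ : Finset (Site d)) (ν μ : Measure (Config d q))
    (g : ℝ) : Prop :=
  ∃ h : ℝ → ℝ,
    (∀ᶠ t : ℝ in 𝓝[≥] 0, relEntropy Λ (P.evolve ν t.toNNReal) μ = (h t : EReal)) ∧
    HasDerivWithinAt h g (Set.Ici 0) 0

end IPS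

end

open MeasureTheory ProbabilityTheory Filter Topology
open scoped ENNReal NNReal

noncomputable section

namespace IPS

variable {d q : ℕ}

/-! ### A divergence argument for sequences -/

/-! The entropy loss of `ν` in a box is `∫ 𝓛φ dν` with `φ(σ) = log (ν(σ)/μ(σ))`. Pair each
transition `σ → σ^{x,i}`, with flux `A`, with its reverse, with flux `B`. The loss then becomes
`-1/2` times the sum of `(A - B)(φ(σ) - φ(σ^{x,i}))`. If the rates at `x` were determined by the
pattern in the box, the detailed balance of `μ` would turn the difference of `φ` into `log A - log
B`. Every term would then be nonnegative, and zero loss would force `A = B`. In general the rates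
see the outside, so there is an error governed by their variation given the pattern. `sum_defect_le`
bounds it by Cauchy–Schwarz: the sum over `x` of the defects of balance `α_n(x)` is at most a
constant times `∑ ρ_n(x) √α_n(x)`, where `ρ_n(x)` is the influence on `x` from beyond the box.

The boundary term is not small by itself. For `d ≤ 2` a shell of width `k` has `O(k n)` sites, so
the first-moment condition gives `∑ ρ_n = O(n)`, and `S_n = ∑ α_n` satisfies `S_n² ≤ C (n + 1) ∑ ρ_n
α_n`. The defect at a site increases with the box (`defect_mono`), so shell sums of `α_n` are at
most `S_n - S_{n-k}`. Summation over `n` then telescopes to `∑_{n ≤ M} S_n²/(n + 1) ≤ C' S_M`, and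
divergence of the harmonic series leaves only `S = 0` (`eq_zero_of_boundary_estimate`). Thus `ν` is
balanced in every box.

Detailed balance determines the conditional probabilities in finite volumes. Applied to `μ`, which
is Gibbs and fully supported, it gives pointwise balance equations for the continuous densities of
`γ` (`rate_mul_density_eq`). Applied to `ν`, the same rates then move mass between patterns exactly
as `γ` prescribes, which is the DLR equation (`mem_gibbsMeasures_of_isBalanced`). -/

/-- A nonnegative sequence with `∑_{n ≤ M} S_n² / (n + 1) ≤ K S_M` vanishes. -/
theorem eq_zero_of_sum_sq_div_le {S : ℕ → ℝ} (h0 : ∀ n, 0 ≤ S n) {K : ℝ}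
    (h : ∀ M : ℕ, ∑ n ∈ Finset.range (M + 1), S n ^ 2 / ((n : ℝ) + 1) ≤ K * S M) (n : ℕ) :
    S n = 0 := by
  by_contra hn
  have hn : 0 < S n := lt_of_le_of_ne (h0 n) (Ne.symm hn)
  set V : ℕ → ℝ := fun M => ∑ n ∈ Finset.range M, S n ^ 2 / ((n : ℝ) + 1) with hV
  have hVs : ∀ M, V (M + 1) = V M + S M ^ 2 / ((M : ℝ) + 1) := fun M =>
    Finset.sum_range_succ _ _
  have hVm : Monotone V := monotone_nat_of_le_succ fun M => by
    rw [hVs]; have : 0 ≤ S M ^ 2 / ((M : ℝ) + 1) := by positivity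
    linarith
  have hV1 : 0 < V (n + 1) := by
    have h1 : 0 ≤ V n := Finset.sum_nonneg fun i _ => by positivity
    have h2 : 0 < S n ^ 2 / ((n : ℝ) + 1) := by positivity
    rw [hVs]; linarith
  have hK : 0 < K := by
    by_contra hK
    have := h n
    have h3 : K * S n ≤ 0 := mul_nonpos_of_nonpos_of_nonneg (not_lt.1 hK) (h0 n)
    have h4 : V (n + 1) ≤ K * S n := this
    linarith
  -- Discrete form of `V' ≥ V² / (K² (M + 1))`: combine `V_{M+1} ≤ K S_M` with `S_M² = (V_{M+1} -
  -- V_M)(M + 1)` and `V_M ≤ V_{M+1}`, then divide by `V_M V_{M+1}`. The telescoping right side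
  -- bounds the harmonic sums, a contradiction.
  have step : ∀ M, n + 1 ≤ M → 1 / ((M : ℝ) + 1) ≤ K ^ 2 * (1 / V M - 1 / V (M + 1)) := by
    intro M hM
    have hVM : 0 < V M := hV1.trans_le (hVm hM)
    have hVM1 : 0 < V (M + 1) := hV1.trans_le (hVm (hM.trans M.le_succ))
    have hle : V M ≤ V (M + 1) := hVm M.le_succ
    have h1 : V (M + 1) ^ 2 ≤ (K * S M) ^ 2 := pow_le_pow_left₀ hVM1.le (h M) 2
    have h2 : S M ^ 2 = (V (M + 1) - V M) * ((M : ℝ) + 1) := by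
      rw [hVs]; field_simp; ring
    rw [mul_pow, h2] at h1
    have h3 : V M * V (M + 1) ≤ K ^ 2 * ((V (M + 1) - V M) * ((M : ℝ) + 1)) := by nlinarith
    rw [div_sub_div _ _ hVM.ne' hVM1.ne', ← mul_div_assoc, div_le_div_iff₀ (by positivity)
      (by positivity)]
    linarith
  have bound : ∀ N, n + 1 ≤ N → ∑ i ∈ Finset.range N, (1 : ℝ) / ((i : ℝ) + 1) ≤
      ∑ i ∈ Finset.range (n + 1), (1 : ℝ) / ((i : ℝ) + 1)
        + K ^ 2 * (1 / V (n + 1) - 1 / V N) := by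
    intro N hN
    induction N, hN using Nat.le_induction with
    | base => simp
    | succ N hN ih =>
      rw [Finset.sum_range_succ]
      have := step N hN
      linarith
  obtain ⟨N, hN, hN'⟩ := ((Real.tendsto_sum_range_one_div_nat_succ_atTop.eventually_gt_atTop
    (∑ i ∈ Finset.range (n + 1), (1 : ℝ) / ((i : ℝ) + 1) + K ^ 2 * (1 / V (n + 1)))).and
    (eventually_ge_atTop (n + 1))).exists
  have h1 := bound N hN'
  have h2 : 0 ≤ K ^ 2 * (1 / V N) := by
    have := hV1.trans_le (hVm hN')
    positivity
  rw [mul_sub] at h1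
  linarith

/-- Telescoping with lag `k` leaves at most the last `k` terms, each bounded by `S M`. -/
theorem sum_range_sub_shift_le {S : ℕ → ℝ} (h0 : ∀ n, 0 ≤ S n) (hS : Monotone S) (k M : ℕ) :
    ∑ n ∈ Finset.range (M + 1), (S n - if k ≤ n then S (n - k) else 0) ≤ k * S M := by
  rcases le_or_gt k (M + 1) with hk | hk
  · obtain ⟨m, hm⟩ := Nat.exists_eq_add_of_le hk
    rw [Finset.sum_sub_distrib]
    have h1 : ∑ n ∈ Finset.range (M + 1), (if k ≤ n then S (n - k) else 0) =
        ∑ j ∈ Finset.range m, S j := by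
      rw [hm, Finset.sum_range_add, Finset.sum_eq_zero, zero_add]
      · simp
      · intro x hx
        rw [if_neg (not_le.2 (Finset.mem_range.1 hx))]
    have h2 : ∑ n ∈ Finset.range (M + 1), S n =
        ∑ j ∈ Finset.range m, S j + ∑ j ∈ Finset.range k, S (m + j) := by
      rw [hm, add_comm k m, Finset.sum_range_add]
    have h3 : ∑ j ∈ Finset.range k, S (m + j) ≤ ∑ _j ∈ Finset.range k, S M :=
      Finset.sum_le_sum fun j hj => hS (by have := Finset.mem_range.1 hj; omega)
    simp only [Finset.sum_const, Finset.card_range, nsmul_eq_mul] at h3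
    linarith
  · calc ∑ n ∈ Finset.range (M + 1), (S n - if k ≤ n then S (n - k) else 0)
        ≤ ∑ _n ∈ Finset.range (M + 1), S M := Finset.sum_le_sum fun n hn => by
          have hn := Finset.mem_range.1 hn
          rw [if_neg (by omega), sub_zero]
          exact hS (by omega)
      _ ≤ k * S M := by
          simp only [Finset.sum_const, Finset.card_range, nsmul_eq_mul]
          exact mul_le_mul_of_nonneg_right (by exact_mod_cast hk.le) (h0 M)

/-- Boundary estimate: let `α n x` be nonnegative and increasing in `n`, and let the shells of the
exhaustion `{ℓ ≤ n}` grow at most linearly. If the sum of `α n` over `{ℓ ≤ n}` is bounded by a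
boundary term with weights of finite first moment, then `α` vanishes. -/
theorem eq_zero_of_boundary_estimate {X Y : Type*} (F : ℕ → Finset X) (l : X → ℕ)
    (hF : ∀ n x, x ∈ F n ↔ l x ≤ n) {A K : ℝ} (hA : 0 ≤ A)
    (hcard : ∀ n k : ℕ, (((F n).filter fun x => n < l x + k).card : ℝ) ≤ A * k * (n + 1))
    (D : Y → ℝ) (hD : ∀ y, 0 ≤ D y) (w : Y → ℕ) (hDw : Summable fun y => D y * w y)
    (α : ℕ → X → ℝ) (hα : ∀ n x, 0 ≤ α n x) (hαm : ∀ x, Monotone fun n => α n x)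
    (H : ∀ n, ∑ x ∈ F n, α n x ≤
      K * ∑ x ∈ F n, (∑' y, if n < l x + w y then D y else 0) * √(α n x)) :
    ∀ n, ∀ x ∈ F n, α n x = 0 := by
  set S : ℕ → ℝ := fun n => ∑ x ∈ F n, α n x with hSdef
  set T : ℝ := ∑' y, D y * w y with hT
  set ρ : ℕ → X → ℝ := fun n x => ∑' y, if n < l x + w y then D y else 0 with hρ
  have hT0 : 0 ≤ T := tsum_nonneg fun y => mul_nonneg (hD y) (Nat.cast_nonneg _)
  have hρ0 : ∀ n x, 0 ≤ ρ n x := fun n x => tsum_nonneg fun y => by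
    split_ifs
    exacts [hD y, le_rfl]
  have hsum : ∀ n, ∀ x ∈ F n, Summable fun y => if n < l x + w y then D y else 0 := by
    intro n x hx
    refine Summable.of_nonneg_of_le (fun y => ?_) (fun y => ?_) hDw
    · split_ifs
      exacts [hD y, le_rfl]
    · split_ifs with h
      · have h1 : 1 ≤ w y := by have := (hF n x).1 hx; omega
        have h2 : (1 : ℝ) ≤ w y := by exact_mod_cast h1
        nlinarith [hD y]
      · exact mul_nonneg (hD y) (Nat.cast_nonneg _)
  have hFm : Monotone F := fun m n hmn x hx => (hF n x).2 (((hF m x).1 hx).trans hmn)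
  have hS0 : ∀ n, 0 ≤ S n := fun n => Finset.sum_nonneg fun x _ => hα n x
  have hSm : Monotone S := fun m n hmn =>
    (Finset.sum_le_sum fun x _ => hαm x hmn).trans
      (Finset.sum_le_sum_of_subset_of_nonneg (hFm hmn) fun x _ _ => hα n x)
  -- Seen from a fixed `y`, the sites with a boundary contribution form the outer shell of width `w
  -- y`. Exchanging the sums reduces everything to shell sums.
  have hweight : ∀ (n : ℕ) (b : X → ℝ), ∑ x ∈ F n, ρ n x * b x =
      ∑' y, D y * ∑ x ∈ (F n).filter (fun x => n < l x + w y), b x := by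
    intro n b
    simp only [hρ, ← tsum_mul_right]
    rw [← Summable.tsum_finsetSum fun x hx => (hsum n x hx).mul_right (b x)]
    refine tsum_congr fun y => ?_
    rw [Finset.mul_sum, Finset.sum_filter]
    exact Finset.sum_congr rfl fun x _ => by split_ifs <;> simp
  have hsumw : ∀ (n : ℕ) (b : X → ℝ), Summable fun y =>
      D y * ∑ x ∈ (F n).filter (fun x => n < l x + w y), b x := by
    intro n b
    have := summable_sum fun x hx => (hsum n x hx).mul_right (b x)
    refine this.congr fun y => ?_
    rw [Finset.mul_sum, Finset.sum_filter]
    exact Finset.sum_congr rfl fun x _ => by split_ifs <;> simp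
  have h1 : ∀ n : ℕ, ∑ x ∈ F n, ρ n x ≤ A * T * (n + 1) := by
    intro n
    have := hweight n fun _ => 1
    simp only [mul_one, Finset.sum_const, nsmul_eq_mul] at this
    rw [this]
    have hs := hsumw n fun _ => 1
    simp only [mul_one, Finset.sum_const, nsmul_eq_mul] at hs
    refine (hs.tsum_le_tsum (fun y => ?_) (hDw.mul_right (A * (n + 1)))).trans (le_of_eq ?_)
    · calc _ ≤ D y * (A * w y * (n + 1)) := mul_le_mul_of_nonneg_left (hcard n (w y)) (hD y)
        _ = _ := by ring
    · rw [tsum_mul_right]; ring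
  have h2 : ∀ M : ℕ, ∑ n ∈ Finset.range (M + 1), ∑ x ∈ F n, ρ n x * α n x ≤ T * S M := by
    intro M
    have hb : ∀ k : ℕ, ∑ n ∈ Finset.range (M + 1),
        ∑ x ∈ (F n).filter (fun x => n < l x + k), α n x ≤ k * S M := by
      intro k
      refine (Finset.sum_le_sum fun n _ => ?_).trans (sum_range_sub_shift_le hS0 hSm k M)
      have h := Finset.sum_filter_add_sum_filter_not (F n) (fun x => n < l x + k) (α n)
      -- The complement of the shell is `F (n - k)`, on which `α n ≥ α (n - k)`. The shell sum is
      -- therefore at most `S n - S (n - k)`, and the sum over `n` telescopes.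
      suffices (if k ≤ n then S (n - k) else 0) ≤
          ∑ x ∈ (F n).filter (fun x => ¬ n < l x + k), α n x by
        change _ ≤ ∑ x ∈ F n, α n x - _
        linarith
      split_ifs with hkn
      · refine (Finset.sum_le_sum fun x _ => hαm x (Nat.sub_le n k)).trans ?_
        refine Finset.sum_le_sum_of_subset_of_nonneg (fun x hx => ?_) fun x _ _ => hα n x
        have := (hF _ x).1 hx
        exact Finset.mem_filter.2 ⟨(hF n x).2 (by omega), by omega⟩
      · exact Finset.sum_nonneg fun x _ => hα n x
    simp only [hweight]
    rw [← Summable.tsum_finsetSum fun n _ => hsumw n (α n), hT, ← tsum_mul_right]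
    refine (summable_sum fun n _ => hsumw n (α n)).tsum_le_tsum (fun y => ?_) (hDw.mul_right (S M))
    rw [← Finset.mul_sum, mul_assoc]
    exact mul_le_mul_of_nonneg_left (hb (w y)) (hD y)
  -- Cauchy–Schwarz with weight `ρ n`, whose total mass is `O(n)` by `h1`.
  have h3 : ∀ n : ℕ, S n ^ 2 / ((n : ℝ) + 1) ≤ K ^ 2 * (A * T) * ∑ x ∈ F n, ρ n x * α n x := by
    intro n
    have hcs : (∑ x ∈ F n, ρ n x * √(α n x)) ^ 2 ≤
        (∑ x ∈ F n, ρ n x) * ∑ x ∈ F n, ρ n x * α n x :=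
      Finset.sum_sq_le_sum_mul_sum_of_sq_le_mul _ (fun x _ => hρ0 n x)
        (fun x _ => mul_nonneg (hρ0 n x) (hα n x)) fun x _ => by
          rw [mul_pow, Real.sq_sqrt (hα n x)]; exact le_of_eq (by ring)
    have hnn : 0 ≤ ∑ x ∈ F n, ρ n x * α n x :=
      Finset.sum_nonneg fun x _ => mul_nonneg (hρ0 n x) (hα n x)
    rw [div_le_iff₀ (by positivity)]
    calc S n ^ 2 ≤ (K * ∑ x ∈ F n, ρ n x * √(α n x)) ^ 2 := pow_le_pow_left₀ (hS0 n) (H n) 2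
      _ = K ^ 2 * (∑ x ∈ F n, ρ n x * √(α n x)) ^ 2 := by ring
      _ ≤ K ^ 2 * ((A * T * (n + 1)) * ∑ x ∈ F n, ρ n x * α n x) := by
          refine mul_le_mul_of_nonneg_left (hcs.trans ?_) (sq_nonneg K)
          exact mul_le_mul_of_nonneg_right (h1 n) hnn
      _ = _ := by ring
  have h4 := eq_zero_of_sum_sq_div_le hS0 (K := K ^ 2 * (A * T) * T) fun M => by
    calc ∑ n ∈ Finset.range (M + 1), S n ^ 2 / ((n : ℝ) + 1)
        ≤ ∑ n ∈ Finset.range (M + 1), K ^ 2 * (A * T) * ∑ x ∈ F n, ρ n x * α n x :=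
          Finset.sum_le_sum fun n _ => h3 n
      _ ≤ _ := by
          rw [← Finset.mul_sum, mul_assoc _ T]
          exact mul_le_mul_of_nonneg_left (h2 M) (by positivity)
  intro n x hx
  exact (Finset.sum_eq_zero_iff_of_nonneg fun x _ => hα n x).1 (h4 n) x hx

/-! ### Cylinder sets and cylinder functions -/

theorem cyl_eq_preimage (Λ : Finset (Site d)) (σ : Λ → Fin q) :
    cyl Λ σ = (Λ.restrict : Config d q → (Λ → Fin q)) ⁻¹' {σ} := by
  ext ω
  simp [cyl, funext_iff]

theorem mem_cyl {Λ : Finset (Site d)} {σ : Λ → Fin q} {ω : Config d q} :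
    ω ∈ cyl Λ σ ↔ Λ.restrict ω = σ := by
  rw [cyl_eq_preimage]; rfl

theorem continuous_restrict (Λ : Finset (Site d)) :
    Continuous (Λ.restrict : Config d q → (Λ → Fin q)) :=
  continuous_pi fun x => continuous_apply (x : Site d)

theorem isClopen_cyl (Λ : Finset (Site d)) (σ : Λ → Fin q) : IsClopen (cyl Λ σ) := by
  rw [cyl_eq_preimage]
  exact (isClopen_discrete _).preimage (continuous_restrict Λ)

theorem measurableSet_cyl (Λ : Finset (Site d)) (σ : Λ → Fin q) : MeasurableSet (cyl Λ σ) :=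
  (isClopen_cyl Λ σ).isOpen.measurableSet

theorem restrict_update {Λ : Finset (Site d)} (η : Config d q) (x : Λ) (i : Fin q) :
    Λ.restrict (Function.update η x i) = Function.update (Λ.restrict η) x i := by
  ext y
  by_cases h : y = x
  · subst h; simp [Finset.restrict]
  · have : (y : Site d) ≠ x := fun h' => h (Subtype.ext h')
    simp [Finset.restrict, h, this]

theorem restrict_update_of_notMem {Λ : Finset (Site d)} (η : Config d q) {x : Site d}
    (hx : x ∉ Λ) (i : Fin q) : Λ.restrict (Function.update η x i) = Λ.restrict η := by
  ext y
  have : (y : Site d) ≠ x := fun h' => hx (h' ▸ y.2)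
  simp [Finset.restrict, this]

/-- The cylinder function `η ↦ φ(η_Λ)`. -/
def cylFun (Λ : Finset (Site d)) (φ : (Λ → Fin q) → ℝ) : C(Config d q, ℝ) :=
  ⟨fun η => φ (Λ.restrict η), continuous_of_discreteTopology.comp (continuous_restrict Λ)⟩

/-- The function `𝓛 f` for the cylinder function `f = cylFun Λ φ`. -/
def genCyl (c : Rates d q) (hc : c.IsContinuous) (Λ : Finset (Site d))
    (φ : (Λ → Fin q) → ℝ) : C(Config d q, ℝ) :=
  ⟨fun η => ∑ x : Λ, ∑ i : Fin q,
      c x η i * (φ (Function.update (Λ.restrict η) x i) - φ (Λ.restrict η)),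
    continuous_finsetSum _ fun x _ => continuous_finsetSum _ fun i _ =>
      (hc x i).mul <| Continuous.comp (g := fun σ => φ (Function.update σ x i) - φ σ)
        continuous_of_discreteTopology (continuous_restrict Λ)⟩

theorem cylFun_mem_preGenerator (c : Rates d q) (hc : c.IsContinuous) (Λ : Finset (Site d))
    (φ : (Λ → Fin q) → ℝ) : (cylFun Λ φ, genCyl c hc Λ φ) ∈ c.preGenerator := by
  constructor
  · have h0 : ∀ x ∉ Λ, osc x (cylFun Λ φ) = 0 := by
      intro x hx
      simp [osc, cylFun, restrict_update_of_notMem _ hx]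
    rw [tsum_eq_sum h0]
    refine ENNReal.sum_lt_top.2 fun x _ => ?_
    refine lt_of_le_of_lt (iSup_le fun η => iSup_le fun i => ?_)
      (ENNReal.ofReal_lt_top (r := 2 * ∑ σ, ‖φ σ‖))
    rw [← ofReal_norm]
    refine ENNReal.ofReal_le_ofReal ((norm_sub_le _ _).trans ?_)
    have h : ∀ τ, ‖φ τ‖ ≤ ∑ σ, ‖φ σ‖ := fun τ =>
      Finset.single_le_sum (f := fun σ => ‖φ σ‖) (fun _ _ => norm_nonneg _) (Finset.mem_univ τ)
    have h1 := h (Λ.restrict (Function.update η x i))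
    have h2 := h (Λ.restrict η)
    simp only [cylFun, ContinuousMap.coe_mk]
    linarith
  · intro η
    have h0 : ∀ x ∉ Λ, ∑ i : Fin q, c x η i *
        (cylFun Λ φ (Function.update η x i) - cylFun Λ φ η) = 0 := by
      intro x hx
      simp [cylFun, restrict_update_of_notMem _ hx]
    have h1 := hasSum_sum_of_ne_finset_zero (L := .unconditional _) h0
    rw [← Finset.sum_coe_sort] at h1
    simpa [genCyl, cylFun, restrict_update] using h1

/-! ### Time derivatives -/

theorem MarkovSemigroup.integral_evolve (P : MarkovSemigroup d q) (ν : Measure (Config d q))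
    [IsProbabilityMeasure ν] (t : ℝ≥0) (f : C(Config d q, ℝ)) :
    ∫ η, f η ∂(P.evolve ν t) = ∫ η, P.op t f η ∂ν := by
  have := P.isMarkovKernel t
  have h := Kernel.integral_comp (κ := Kernel.const Unit ν) (η := P.kernel t) (a := ()) (f := f)
  rw [← Measure.comp_eq_comp_const_apply, Kernel.const_apply] at h
  rw [MarkovSemigroup.evolve, h]
  · rfl
  · exact f.continuous.integrable_of_hasCompactSupport (HasCompactSupport.of_compactSpace f)

theorem integrable_continuousMap (ν : Measure (Config d q)) [IsFiniteMeasure ν]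
    (f : C(Config d q, ℝ)) : Integrable f ν :=
  f.continuous.integrable_of_hasCompactSupport (HasCompactSupport.of_compactSpace f)

theorem tendsto_integral_mul (ν : Measure (Config d q)) [IsFiniteMeasure ν]
    (k : C(Config d q, ℝ)) {ι : Type*} {l : Filter ι} {F : ι → C(Config d q, ℝ)}
    {g : C(Config d q, ℝ)} (h : Tendsto F l (𝓝 g)) :
    Tendsto (fun t => ∫ η, k η * F t η ∂ν) l (𝓝 (∫ η, k η * g η ∂ν)) := by
  rw [tendsto_iff_norm_sub_tendsto_zero] at h ⊢
  have h1 := h.const_mul (‖k‖ * ν.real Set.univ)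
  rw [mul_zero] at h1
  refine squeeze_zero (fun _ => norm_nonneg _) (fun t => ?_) h1
  have h2 := integral_sub (integrable_continuousMap ν (k * F t)) (integrable_continuousMap ν (k * g))
  simp only [ContinuousMap.mul_apply] at h2
  rw [← h2]
  refine (norm_integral_le_of_norm_le_const (C := ‖k‖ * ‖F t - g‖) (ae_of_all _ fun η => ?_)).trans
    (le_of_eq (by ring))
  rw [← mul_sub, norm_mul]
  exact mul_le_mul (k.norm_coe_le_norm η) ((F t - g).norm_coe_le_norm η) (norm_nonneg _)
    (norm_nonneg _)

/-- For `(f, g)` in the generator, `d/dt ∫ k P_t f dν = ∫ k g dν` at `t = 0`. -/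
theorem hasDerivWithinAt_integral_op (P : MarkovSemigroup d q) (ν : Measure (Config d q))
    [IsFiniteMeasure ν] (k : C(Config d q, ℝ)) {f g : C(Config d q, ℝ)}
    (h : (f, g) ∈ P.generator) :
    HasDerivWithinAt (fun t : ℝ => ∫ η, k η * P.op t.toNNReal f η ∂ν) (∫ η, k η * g η ∂ν)
      (Set.Ici 0) 0 := by
  have hI : Set.Ici (0 : ℝ) \ {0} = Set.Ioi 0 := by
    ext t; simp [lt_iff_le_and_ne, eq_comm]
  rw [hasDerivWithinAt_iff_tendsto_slope, hI]
  have h0 : P.op 0 f = f := by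
    ext η
    simp [MarkovSemigroup.op, P.kernel_zero, Kernel.id_apply]
  have ht : Tendsto Real.toNNReal (𝓝[>] (0 : ℝ)) (𝓝[>] (0 : ℝ≥0)) := by
    refine tendsto_nhdsWithin_iff.2 ⟨?_, ?_⟩
    · have := (continuous_real_toNNReal.tendsto 0).mono_left (nhdsWithin_le_nhds (s := Set.Ioi 0))
      simpa using this
    · filter_upwards [self_mem_nhdsWithin] with t ht
      simpa using ht
  refine (tendsto_integral_mul ν k (h.comp ht)).congr' ?_
  filter_upwards [self_mem_nhdsWithin] with t ht
  have ht' : (0 : ℝ) < t := ht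
  have h2 := integral_sub (integrable_continuousMap ν (k * P.op t.toNNReal f))
    (integrable_continuousMap ν (k * f))
  simp only [ContinuousMap.mul_apply] at h2
  rw [slope_def_field, Real.toNNReal_zero, h0, sub_zero, ← h2, div_eq_inv_mul,
    ← integral_const_mul]
  refine integral_congr_ae (ae_of_all _ fun η => ?_)
  simp [Real.coe_toNNReal t ht'.le]
  ring

/-! ### Probability fluxes -/

/-- The flux `∫_{[σ]} c_x(η, i) ν(dη)` of transitions that put the spin `i` at `x`, out of the
pattern `σ`. -/
def flux (c : Rates d q) (ν : Measure (Config d q)) (Λ : Finset (Site d)) (x : Λ)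
    (σ : Λ → Fin q) (i : Fin q) : ℝ :=
  ∫ η in cyl Λ σ, c x η i ∂ν

theorem integral_eq_sum_cyl (ν : Measure (Config d q)) (Λ : Finset (Site d))
    {f : Config d q → ℝ} (hf : Integrable f ν) :
    ∫ η, f η ∂ν = ∑ σ : Λ → Fin q, ∫ η in cyl Λ σ, f η ∂ν := by
  have hU : ⋃ σ : Λ → Fin q, cyl Λ σ = Set.univ :=
    Set.eq_univ_of_forall fun η => Set.mem_iUnion.2 ⟨Λ.restrict η, mem_cyl.2 rfl⟩
  rw [← setIntegral_univ, ← hU, integral_iUnion_fintype (measurableSet_cyl Λ)]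
  · intro σ τ hστ
    exact Set.disjoint_left.2 fun η h1 h2 => hστ ((mem_cyl.1 h1).symm.trans (mem_cyl.1 h2))
  · exact fun σ => hf.integrableOn

theorem integrable_rate {c : Rates d q} (hc : c.IsContinuous) (ν : Measure (Config d q))
    [IsFiniteMeasure ν] (x : Site d) (i : Fin q) : Integrable (fun η => c x η i) ν :=
  integrable_continuousMap ν ⟨_, hc x i⟩

theorem integral_genCyl (c : Rates d q) (hc : c.IsContinuous) (ν : Measure (Config d q))
    [IsFiniteMeasure ν] (Λ : Finset (Site d)) (φ : (Λ → Fin q) → ℝ) :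
    ∫ η, genCyl c hc Λ φ η ∂ν = ∑ x : Λ, ∑ i : Fin q, ∑ σ : Λ → Fin q,
      flux c ν Λ x σ i * (φ (Function.update σ x i) - φ σ) := by
  have hInt : ∀ (x : Λ) (i : Fin q), Integrable (fun η => c x η i *
      (φ (Function.update (Λ.restrict η) x i) - φ (Λ.restrict η))) ν := fun x i =>
    integrable_continuousMap ν ((⟨_, hc x i⟩ : C(Config d q, ℝ)) *
      cylFun Λ fun σ => φ (Function.update σ x i) - φ σ)
  simp only [genCyl, ContinuousMap.coe_mk]
  rw [integral_finsetSum _ fun x _ => integrable_finsetSum _ fun i _ => hInt x i]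
  refine Finset.sum_congr rfl fun x _ => ?_
  rw [integral_finsetSum _ fun i _ => hInt x i]
  refine Finset.sum_congr rfl fun i _ => ?_
  rw [integral_eq_sum_cyl ν Λ (hInt x i)]
  refine Finset.sum_congr rfl fun σ _ => ?_
  rw [flux, ← integral_mul_const]
  refine setIntegral_congr_fun (measurableSet_cyl Λ σ) fun η hη => ?_
  simp only [mem_cyl.1 hη]

theorem integral_cylFun_single (ν : Measure (Config d q)) (Λ : Finset (Site d))
    (σ : Λ → Fin q) (f : Config d q → ℝ) :
    ∫ η, cylFun Λ (Pi.single σ 1) η * f η ∂ν = ∫ η in cyl Λ σ, f η ∂ν := by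
  rw [← integral_indicator (measurableSet_cyl Λ σ)]
  refine integral_congr_ae (ae_of_all _ fun η => ?_)
  by_cases h : Λ.restrict η = σ
  · simp [cylFun, Set.indicator_of_mem (mem_cyl.2 h), h]
  · rw [Set.indicator_of_notMem (fun h' => h (mem_cyl.1 h'))]
    simp [cylFun, h]

/-- For `i ≠ σ x`, the only single-site transition from `σ` to `σ^{x,i}` puts `i` at `x`, so on
`[σ]` the generator applied to the indicator of `[σ^{x,i}]` is `c_x(·, i)`. -/
theorem integral_cylFun_mul_genCyl (c : Rates d q) (hc : c.IsContinuous)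
    (ν : Measure (Config d q)) (Λ : Finset (Site d)) (x : Λ)
    (σ : Λ → Fin q) (i : Fin q) (hi : i ≠ σ x) :
    ∫ η, cylFun Λ (Pi.single σ 1) η *
      genCyl c hc Λ (Pi.single (Function.update σ x i) 1) η ∂ν = flux c ν Λ x σ i := by
  rw [integral_cylFun_single, flux]
  refine setIntegral_congr_fun (measurableSet_cyl Λ σ) fun η hη => ?_
  have h1 : σ ≠ Function.update σ x i := fun h => hi (by
    have := congrFun h x
    simpa using this.symm)
  simp only [genCyl, ContinuousMap.coe_mk, mem_cyl.1 hη]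
  rw [Finset.sum_eq_single x, Finset.sum_eq_single i]
  · simp [h1]
  · intro k _ hk
    have h2 : Function.update σ x k ≠ Function.update σ x i := fun h => hk (by
      have := congrFun h x
      simpa using this)
    simp [h1, h2]
  · simp
  · intro y _ hy
    refine Finset.sum_eq_zero fun k _ => ?_
    have h2 : Function.update σ y k ≠ Function.update σ x i := fun h => hi (by
      have := congrFun h x
      simpa [Function.update_of_ne hy.symm] using this.symm)
    simp [h1, h2]
  · simp

theorem update_update_self {ι : Type*} [DecidableEq ι] (σ : ι → Fin q) (x : ι) (i : Fin q) :
    Function.update (Function.update σ x i) x (σ x) = σ := by simp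

/-- The detailed balance equations for the fluxes of a measure in a finite volume. -/
def IsBalanced (c : Rates d q) (ν : Measure (Config d q)) (Λ : Finset (Site d)) : Prop :=
  ∀ (x : Λ) (σ : Λ → Fin q) (i : Fin q),
    flux c ν Λ x σ i = flux c ν Λ x (Function.update σ x i) (σ x)

theorem mem_generator {c : Rates d q} (hc : c.IsContinuous) {P : MarkovSemigroup d q}
    (hP : P.IsGeneratedBy c) (Λ : Finset (Site d)) (φ : (Λ → Fin q) → ℝ) :
    (cylFun Λ φ, genCyl c hc Λ φ) ∈ P.generator := by
  rw [show P.generator = _ from hP]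
  exact subset_closure (cylFun_mem_preGenerator c hc Λ φ)

theorem MarkovSemigroup.IsReversible.isBalanced {c : Rates d q} (hc : c.IsContinuous)
    {P : MarkovSemigroup d q} (hP : P.IsGeneratedBy c) {μ : Measure (Config d q)}
    [IsFiniteMeasure μ] (hμ : P.IsReversible μ) (Λ : Finset (Site d)) : IsBalanced c μ Λ := by
  intro x σ i
  by_cases hi : i = σ x
  · subst hi; simp
  have h1 := hasDerivWithinAt_integral_op P μ (cylFun Λ (Pi.single σ 1))
    (mem_generator hc hP Λ (Pi.single (Function.update σ x i) 1))
  have h2 := hasDerivWithinAt_integral_op P μ (cylFun Λ (Pi.single (Function.update σ x i) 1))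
    (mem_generator hc hP Λ (Pi.single σ 1))
  -- Reversibility identifies the two functions of time, hence their derivatives at `0`, which are
  -- the flux and the reverse flux.
  simp only [hμ _ (cylFun Λ (Pi.single σ 1)) _] at h1
  have h3 := (uniqueDiffWithinAt_Ici (0 : ℝ)).eq_deriv _ h1 h2
  rw [integral_cylFun_mul_genCyl c hc μ Λ x σ i hi] at h3
  have h4 := integral_cylFun_mul_genCyl c hc μ Λ x (Function.update σ x i) (σ x)
    (by simpa using Ne.symm hi)
  rw [update_update_self] at h4
  rw [h3, h4]

/-! ### Bounds on the fluxes -/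

theorem real_cyl_mul_le_flux {c : Rates d q} (hc : c.IsContinuous) {ν : Measure (Config d q)}
    [IsFiniteMeasure ν] {Λ : Finset (Site d)} (x : Λ) (σ : Λ → Fin q) (i : Fin q) {a : ℝ}
    (ha : ∀ η ∈ cyl Λ σ, a ≤ c x η i) : a * ν.real (cyl Λ σ) ≤ flux c ν Λ x σ i := by
  have h := setIntegral_mono_on (μ := ν) (integrableOn_const (C := a) (by finiteness))
    (integrable_rate hc ν x i).integrableOn (measurableSet_cyl Λ σ) ha
  rw [setIntegral_const, smul_eq_mul, mul_comm] at h
  exact h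

theorem flux_le_real_cyl_mul {c : Rates d q} (hc : c.IsContinuous) {ν : Measure (Config d q)}
    [IsFiniteMeasure ν] {Λ : Finset (Site d)} (x : Λ) (σ : Λ → Fin q) (i : Fin q) {a : ℝ}
    (ha : ∀ η ∈ cyl Λ σ, c x η i ≤ a) : flux c ν Λ x σ i ≤ a * ν.real (cyl Λ σ) := by
  have h := setIntegral_mono_on (μ := ν) (integrable_rate hc ν x i).integrableOn
    (integrableOn_const (C := a) (by finiteness)) (measurableSet_cyl Λ σ) ha
  rw [setIntegral_const, smul_eq_mul, mul_comm _ a] at h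
  exact h

theorem cyl_nonempty_of_real_pos {ν : Measure (Config d q)} {Λ : Finset (Site d)}
    {σ : Λ → Fin q} (h : 0 < ν.real (cyl Λ σ)) : (cyl Λ σ).Nonempty := by
  by_contra hne
  rw [Set.not_nonempty_iff_eq_empty.1 hne] at h
  simp at h

/-- The averages of a rate over a cylinder set with respect to two measures differ at most by
the variation of the rate. -/
theorem flux_div_sub_le {c : Rates d q} (hc : c.IsContinuous) {ν μ : Measure (Config d q)}
    [IsFiniteMeasure ν] [IsFiniteMeasure μ] {Λ : Finset (Site d)} (x : Λ) (σ : Λ → Fin q)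
    (i : Fin q) {r : ℝ} (hr : ∀ η ∈ cyl Λ σ, ∀ ξ ∈ cyl Λ σ, c x η i - c x ξ i ≤ r)
    (hν : 0 < ν.real (cyl Λ σ)) (hμ : 0 < μ.real (cyl Λ σ)) :
    flux c ν Λ x σ i / ν.real (cyl Λ σ) - flux c μ Λ x σ i / μ.real (cyl Λ σ) ≤ r := by
  have h1 : ∀ ξ ∈ cyl Λ σ, flux c ν Λ x σ i / ν.real (cyl Λ σ) - r ≤ c x ξ i := by
    intro ξ hξ
    have := flux_le_real_cyl_mul (ν := ν) hc x σ i (a := c x ξ i + r)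
      fun η hη => by linarith [hr η hη ξ hξ]
    rw [sub_le_iff_le_add, div_le_iff₀ hν]
    exact this
  have h2 := real_cyl_mul_le_flux (ν := μ) hc x σ i h1
  rw [← le_div_iff₀ hμ] at h2
  linarith

theorem sum_real_cyl (ν : Measure (Config d q)) [IsProbabilityMeasure ν]
    (Λ : Finset (Site d)) : ∑ σ : Λ → Fin q, ν.real (cyl Λ σ) = 1 := by
  have := integral_eq_sum_cyl ν Λ (integrable_const (μ := ν) (1 : ℝ))
  simpa using this.symm

/-- A property of patterns that is stable under changes of single spins holds for all patterns. -/
theorem forall_of_forall_update {Λ : Finset (Site d)} {p : (Λ → Fin q) → Prop}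
    (h : ∀ σ x i, p σ → p (Function.update σ x i)) {σ : Λ → Fin q} (hσ : p σ)
    (τ : Λ → Fin q) : p τ := by
  suffices hs : ∀ s : Finset Λ, p (s.piecewise τ σ) by
    have := hs Finset.univ
    rwa [Finset.piecewise_univ] at this
  intro s
  induction s using Finset.induction_on with
  | empty => simpa using hσ
  | insert x s _ ih =>
    rw [Finset.piecewise_insert]
    exact h _ x _ ih

/-- A null pattern has zero outgoing flux. By balance, each of its single-spin neighbours then has
zero flux into it; as rates are at least `δ`, the neighbours are null as well. Some pattern has
positive mass, and single-spin changes connect all patterns. -/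
theorem IsBalanced.real_cyl_pos {c : Rates d q} (hc : c.IsContinuous) (hpos : c.IsBoundedBelow)
    {μ : Measure (Config d q)} [IsProbabilityMeasure μ] {Λ : Finset (Site d)}
    (h : IsBalanced c μ Λ) (σ : Λ → Fin q) : 0 < μ.real (cyl Λ σ) := by
  obtain ⟨δ, hδ, hc0⟩ := hpos
  have step : ∀ (τ : Λ → Fin q) (x : Λ) (i : Fin q), 0 < μ.real (cyl Λ τ) →
      0 < μ.real (cyl Λ (Function.update τ x i)) := by
    intro τ x i hτ
    by_contra hn
    have h0 : μ.real (cyl Λ (Function.update τ x i)) = 0 :=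
      le_antisymm (not_lt.1 hn) measureReal_nonneg
    have h1 := real_cyl_mul_le_flux (ν := μ) hc x τ i fun η _ => hc0 x η i
    have h2 : flux c μ Λ x (Function.update τ x i) (τ x) = 0 := by
      rw [flux, Measure.restrict_eq_zero.2 ((measureReal_eq_zero_iff).1 h0), integral_zero_measure]
    rw [h x τ i, h2] at h1
    nlinarith
  obtain ⟨τ, hτ⟩ : ∃ τ : Λ → Fin q, 0 < μ.real (cyl Λ τ) := by
    by_contra! hn
    have := Finset.sum_nonpos fun σ (_ : σ ∈ Finset.univ) => hn σ
    rw [sum_real_cyl] at this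
    linarith
  exact forall_of_forall_update (p := fun σ => 0 < μ.real (cyl Λ σ)) step hτ σ

/-! ### Entropy production -/

theorem sq_sub_div_add_le_mul_log {a b : ℝ} (ha : 0 < a) (hb : 0 < b) :
    (a - b) ^ 2 / (a + b) ≤ (a - b) * (Real.log a - Real.log b) := by
  wlog h : b ≤ a generalizing a b
  · have := this hb ha (not_le.1 h).le
    calc (a - b) ^ 2 / (a + b) = (b - a) ^ 2 / (b + a) := by rw [add_comm a b]; ring
      _ ≤ _ := this
      _ = _ := by ring
  have h1 := Real.one_sub_inv_le_log_of_pos (div_pos ha hb)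
  rw [Real.log_div ha.ne' hb.ne', inv_div] at h1
  have h2 : (a - b) / (a + b) ≤ 1 - b / a := by
    rw [one_sub_div ha.ne']
    exact div_le_div_of_nonneg_left (by linarith) ha (by linarith)
  calc (a - b) ^ 2 / (a + b) = (a - b) * ((a - b) / (a + b)) := by ring
    _ ≤ _ := mul_le_mul_of_nonneg_left (h2.trans h1) (by linarith)

theorem log_sub_log_le {a b r δ : ℝ} (hδ : 0 < δ) (ha : 0 < a) (hb : δ ≤ b)
    (hr : 0 ≤ r) (h : a - b ≤ r) : Real.log a - Real.log b ≤ r / δ := by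
  have hb0 : 0 < b := hδ.trans_le hb
  have h1 := Real.log_le_sub_one_of_pos (div_pos ha hb0)
  rw [Real.log_div ha.ne' hb0.ne'] at h1
  calc _ ≤ a / b - 1 := h1
    _ = (a - b) / b := by field_simp
    _ ≤ r / b := by gcongr
    _ ≤ r / δ := div_le_div_of_nonneg_left hr hδ hb

/-- The defect `∑_{σ, i} (A - B)² / (A + B)` of detailed balance at `x`, where `A` is the flux
from `σ` to `σ^{x,i}` and `B` the reverse flux. -/
def defect (c : Rates d q) (ν : Measure (Config d q)) (Λ : Finset (Site d)) (x : Λ) : ℝ :=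
  ∑ p : (Λ → Fin q) × Fin q,
    (flux c ν Λ x p.1 p.2 - flux c ν Λ x (Function.update p.1 x p.2) (p.1 x)) ^ 2 /
      (flux c ν Λ x p.1 p.2 + flux c ν Λ x (Function.update p.1 x p.2) (p.1 x))

/-- The involution `(σ, i) ↦ (σ^{x,i}, σ_x)`. -/
def swapSpin {ι : Type*} [DecidableEq ι] (x : ι) :
    Equiv.Perm ((ι → Fin q) × Fin q) :=
  Function.Involutive.toPerm (fun p => (Function.update p.1 x p.2, p.1 x)) fun p => by simp

theorem swapSpin_apply {ι : Type*} [DecidableEq ι] (x : ι) (p : (ι → Fin q) × Fin q) :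
    swapSpin x p = (Function.update p.1 x p.2, p.1 x) := rfl

theorem sum_swapSpin {ι : Type*} [DecidableEq ι] [Fintype ι] (x : ι)
    (f : (ι → Fin q) → Fin q → ℝ) :
    ∑ p : (ι → Fin q) × Fin q, f (Function.update p.1 x p.2) (p.1 x) =
      ∑ p : (ι → Fin q) × Fin q, f p.1 p.2 :=
  Equiv.sum_comp (swapSpin x) fun p => f p.1 p.2

theorem flux_pos {c : Rates d q} (hc : c.IsContinuous) {δ : ℝ} (hδ : 0 < δ)
    (hcδ : ∀ x η i, δ ≤ c x η i) {ν : Measure (Config d q)} {Λ : Finset (Site d)}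
    [IsFiniteMeasure ν] (hν : ∀ σ : Λ → Fin q, 0 < ν.real (cyl Λ σ)) (x : Λ)
    (σ : Λ → Fin q) (i : Fin q) : 0 < flux c ν Λ x σ i :=
  (mul_pos hδ (hν σ)).trans_le (real_cyl_mul_le_flux hc x σ i fun η _ => hcδ x η i)

theorem log_flux_div_sub_le {c : Rates d q} (hc : c.IsContinuous) {δ : ℝ} (hδ : 0 < δ)
    (hcδ : ∀ x η i, δ ≤ c x η i) {ν μ : Measure (Config d q)} {Λ : Finset (Site d)}
    [IsFiniteMeasure ν] [IsFiniteMeasure μ]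
    (hν : ∀ σ : Λ → Fin q, 0 < ν.real (cyl Λ σ)) (hμ : ∀ σ : Λ → Fin q, 0 < μ.real (cyl Λ σ))
    (x : Λ) (σ : Λ → Fin q) (i : Fin q) {r : ℝ} (hr0 : 0 ≤ r)
    (hr : ∀ η ∈ cyl Λ σ, ∀ ξ ∈ cyl Λ σ, c x η i - c x ξ i ≤ r) :
    (Real.log (flux c ν Λ x σ i) - Real.log (ν.real (cyl Λ σ))) -
      (Real.log (flux c μ Λ x σ i) - Real.log (μ.real (cyl Λ σ))) ≤ r / δ := by
  have h1 := flux_div_sub_le hc x σ i hr (hν σ) (hμ σ)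
  have h2 := log_sub_log_le hδ (div_pos (flux_pos hc hδ hcδ hν x σ i) (hν σ))
    ((le_div_iff₀ (hμ σ)).2 (real_cyl_mul_le_flux hc x σ i fun η _ => hcδ x η i)) hr0 h1
  rwa [Real.log_div (flux_pos hc hδ hcδ hν x σ i).ne' (hν σ).ne',
    Real.log_div (flux_pos hc hδ hcδ hμ x σ i).ne' (hμ σ).ne'] at h2

/-- Flux divided by cylinder mass is an average of the rate, so its logarithms under `ν` and `μ`
differ by at most `r / δ`. Apply this to `σ` and to `σ^{x,i}`; the two `μ`-fluxes agree by balance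
and cancel. Only `k ≠ τ x` is needed in the bound on the rates, because everything vanishes for `i =
σ x`. -/
theorem abs_log_flux_sub_le {c : Rates d q} (hc : c.IsContinuous) {δ : ℝ} (hδ : 0 < δ)
    (hcδ : ∀ x η i, δ ≤ c x η i) {ν μ : Measure (Config d q)} {Λ : Finset (Site d)}
    [IsFiniteMeasure ν] [IsFiniteMeasure μ]
    (hν : ∀ σ : Λ → Fin q, 0 < ν.real (cyl Λ σ)) (hμ : ∀ σ : Λ → Fin q, 0 < μ.real (cyl Λ σ))
    (hb : IsBalanced c μ Λ) (x : Λ) (σ : Λ → Fin q) (i : Fin q) {r : ℝ} (hr0 : 0 ≤ r)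
    (hr : ∀ (τ : Λ → Fin q) (k : Fin q), k ≠ τ x →
      ∀ η ∈ cyl Λ τ, ∀ ξ ∈ cyl Λ τ, c x η k - c x ξ k ≤ r) :
    |(Real.log (flux c ν Λ x σ i) - Real.log (flux c ν Λ x (Function.update σ x i) (σ x))) -
      ((Real.log (ν.real (cyl Λ σ)) - Real.log (μ.real (cyl Λ σ))) -
        (Real.log (ν.real (cyl Λ (Function.update σ x i))) -
          Real.log (μ.real (cyl Λ (Function.update σ x i)))))| ≤ 2 * (r / δ) := by
  by_cases hi : i = σ x
  · subst hi
    simp only [Function.update_eq_self, sub_self, abs_zero]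
    positivity
  have hi' : σ x ≠ Function.update σ x i x := by simpa using Ne.symm hi
  have h1 := log_flux_div_sub_le hc hδ hcδ hν hμ x σ i hr0 (hr σ i hi)
  have h2 := log_flux_div_sub_le hc hδ hcδ hμ hν x σ i hr0 (hr σ i hi)
  have h3 := log_flux_div_sub_le hc hδ hcδ hν hμ x _ _ hr0 (hr _ _ hi')
  have h4 := log_flux_div_sub_le hc hδ hcδ hμ hν x _ _ hr0 (hr _ _ hi')
  rw [hb x σ i] at h1 h2
  rw [abs_le]
  constructor <;> linarith

/-- If the rate of entropy loss vanishes, then the sum of the defects is bounded by a boundary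
term. -/
theorem sum_defect_le {c : Rates d q} (hc : c.IsContinuous) {δ : ℝ} (hδ : 0 < δ)
    (hcδ : ∀ x η i, δ ≤ c x η i) {ν μ : Measure (Config d q)} {Λ : Finset (Site d)}
    [IsProbabilityMeasure ν] [IsFiniteMeasure μ]
    (hν : ∀ σ : Λ → Fin q, 0 < ν.real (cyl Λ σ)) (hμ : ∀ σ : Λ → Fin q, 0 < μ.real (cyl Λ σ))
    (hb : IsBalanced c μ Λ) {φ : (Λ → Fin q) → ℝ}
    (hφ : ∀ σ, φ σ = Real.log (ν.real (cyl Λ σ)) - Real.log (μ.real (cyl Λ σ)))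
    (hg : ∫ η, genCyl c hc Λ φ η ∂ν = 0) {r : Λ → ℝ} (hr0 : ∀ x, 0 ≤ r x)
    (hr : ∀ (x : Λ) (τ : Λ → Fin q) (k : Fin q), k ≠ τ x →
      ∀ η ∈ cyl Λ τ, ∀ ξ ∈ cyl Λ τ, c x η k - c x ξ k ≤ r x)
    {K : ℝ} (hK : ∀ x η i, c x η i ≤ K) :
    ∑ x, defect c ν Λ x ≤ 2 / δ * √(2 * (q * K)) * ∑ x, r x * √(defect c ν Λ x) := by
  set A : Λ → (Λ → Fin q) × Fin q → ℝ := fun x p => flux c ν Λ x p.1 p.2 with hA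
  set B : Λ → (Λ → Fin q) × Fin q → ℝ :=
    fun x p => flux c ν Λ x (Function.update p.1 x p.2) (p.1 x) with hB
  have hApos : ∀ x p, 0 < A x p := fun x p => flux_pos hc hδ hcδ hν x _ _
  have hBpos : ∀ x p, 0 < B x p := fun x p => flux_pos hc hδ hcδ hν x _ _
  -- Average the sum with its image under the involution `swapSpin`, which exchanges `A` and `B`.
  have hsym : ∀ x, ∑ i : Fin q, ∑ σ : Λ → Fin q,
      flux c ν Λ x σ i * (φ (Function.update σ x i) - φ σ) =
        -(1 / 2) * ∑ p, (A x p - B x p) * (φ p.1 - φ (Function.update p.1 x p.2)) := by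
    intro x
    rw [Finset.sum_comm, ← Fintype.sum_prod_type']
    have h1 := sum_swapSpin x fun σ i =>
      flux c ν Λ x σ i * (φ (Function.update σ x i) - φ σ)
    simp only [Function.update_idem, Function.update_eq_self] at h1
    have h2 : ∑ p, (A x p - B x p) * (φ p.1 - φ (Function.update p.1 x p.2)) =
        -(∑ p, A x p * (φ (Function.update p.1 x p.2) - φ p.1)) -
          ∑ p, B x p * (φ p.1 - φ (Function.update p.1 x p.2)) := by
      rw [← Finset.sum_neg_distrib, ← Finset.sum_sub_distrib]
      exact Finset.sum_congr rfl fun p _ => by ring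
    rw [h2, hB, h1]
    simp only [hA]
    ring
  have hzero : ∑ x, ∑ p, (A x p - B x p) * (φ p.1 - φ (Function.update p.1 x p.2)) = 0 := by
    rw [integral_genCyl, Finset.sum_congr rfl fun x _ => hsym x, ← Finset.mul_sum] at hg
    simpa using hg
  have hle : ∀ x, defect c ν Λ x - 2 * (r x / δ) * ∑ p, |A x p - B x p| ≤
      ∑ p, (A x p - B x p) * (φ p.1 - φ (Function.update p.1 x p.2)) := by
    intro x
    rw [defect, Finset.mul_sum, ← Finset.sum_sub_distrib]
    refine Finset.sum_le_sum fun p _ => ?_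
    have h1 := sq_sub_div_add_le_mul_log (hApos x p) (hBpos x p)
    have h2 := abs_log_flux_sub_le hc hδ hcδ hν hμ hb x p.1 p.2 (hr0 x) (hr x)
    rw [← hφ, ← hφ] at h2
    have h3 := mul_le_mul_of_nonneg_left h2 (abs_nonneg (A x p - B x p))
    rw [← abs_mul] at h3
    have h4 := (le_abs_self _).trans h3
    simp only [hA, hB] at h1 h4 ⊢
    linarith
  -- The `A`-fluxes that put a given spin at `x` sum to at most `K`, as `ν` is a probability
  -- measure; there are `q` spins, and the `B`-fluxes have the same sum as the `A`-fluxes.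
  have hmass : ∀ x, ∑ p, (A x p + B x p) ≤ 2 * (q * K) := by
    intro x
    have h1 : ∑ p, B x p = ∑ p, A x p := sum_swapSpin x fun σ i => flux c ν Λ x σ i
    have h2 : ∑ p, A x p ≤ q * K := by
      rw [Fintype.sum_prod_type_right]
      calc ∑ i : Fin q, ∑ σ, A x (σ, i) ≤ ∑ i : Fin q, K := by
            refine Finset.sum_le_sum fun i _ => ?_
            calc ∑ σ, A x (σ, i) ≤ ∑ σ : Λ → Fin q, K * ν.real (cyl Λ σ) :=
                  Finset.sum_le_sum fun σ _ =>
                    flux_le_real_cyl_mul hc x σ i fun η _ => hK x η i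
              _ = K := by rw [← Finset.mul_sum, sum_real_cyl, mul_one]
        _ = q * K := by simp
    rw [Finset.sum_add_distrib, h1]
    linarith
  have habs : ∀ x, ∑ p, |A x p - B x p| ≤ √(2 * (q * K)) * √(defect c ν Λ x) := by
    intro x
    have hd0 : 0 ≤ defect c ν Λ x := Finset.sum_nonneg fun p _ =>
      div_nonneg (sq_nonneg _) (add_pos (hApos x p) (hBpos x p)).le
    have h1 : (∑ p, |A x p - B x p|) ^ 2 ≤ (∑ p, (A x p + B x p)) * defect c ν Λ x := by
      refine Finset.sum_sq_le_sum_mul_sum_of_sq_le_mul _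
        (fun p _ => (add_pos (hApos x p) (hBpos x p)).le)
        (fun p _ => div_nonneg (sq_nonneg _) (add_pos (hApos x p) (hBpos x p)).le) fun p _ => ?_
      have := (add_pos (hApos x p) (hBpos x p)).ne'
      simp only [hA, hB] at this ⊢
      rw [sq_abs, mul_div_cancel₀ _ this]
    have h2 : 0 ≤ ∑ p, (A x p + B x p) :=
      Finset.sum_nonneg fun p _ => (add_pos (hApos x p) (hBpos x p)).le
    rw [← Real.sqrt_mul (h2.trans (hmass x))]
    exact Real.le_sqrt_of_sq_le (h1.trans (mul_le_mul_of_nonneg_right (hmass x) hd0))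
  have h1 := Finset.sum_le_sum fun x (_ : x ∈ Finset.univ) => hle x
  rw [hzero, Finset.sum_sub_distrib, sub_nonpos] at h1
  refine h1.trans ?_
  rw [Finset.mul_sum]
  refine Finset.sum_le_sum fun x _ => ?_
  calc 2 * (r x / δ) * ∑ p, |A x p - B x p|
      ≤ 2 * (r x / δ) * (√(2 * (q * K)) * √(defect c ν Λ x)) :=
        mul_le_mul_of_nonneg_left (habs x) (by have := hr0 x; positivity)
    _ = _ := by ring

theorem isBalanced_of_defect_eq_zero {c : Rates d q} (hc : c.IsContinuous) {δ : ℝ} (hδ : 0 < δ)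
    (hcδ : ∀ x η i, δ ≤ c x η i) {ν : Measure (Config d q)} {Λ : Finset (Site d)}
    [IsFiniteMeasure ν]
    (hν : ∀ σ : Λ → Fin q, 0 < ν.real (cyl Λ σ)) (h : ∀ x, defect c ν Λ x = 0) :
    IsBalanced c ν Λ := by
  intro x σ i
  have hp : ∀ p : (Λ → Fin q) × Fin q, 0 < flux c ν Λ x p.1 p.2 +
      flux c ν Λ x (Function.update p.1 x p.2) (p.1 x) := fun p =>
    add_pos (flux_pos hc hδ hcδ hν x _ _) (flux_pos hc hδ hcδ hν x _ _)
  have h1 := (Finset.sum_eq_zero_iff_of_nonneg fun p _ =>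
    div_nonneg (sq_nonneg _) (hp p).le).1 (h x) (σ, i) (Finset.mem_univ _)
  rw [div_eq_zero_iff, or_iff_left (hp (σ, i)).ne', sq_eq_zero_iff, sub_eq_zero] at h1
  exact h1

/-! ### The derivative of the relative entropy -/

theorem MarkovSemigroup.real_evolve_cyl (P : MarkovSemigroup d q) (ν : Measure (Config d q))
    [IsProbabilityMeasure ν] (t : ℝ≥0) (Λ : Finset (Site d)) (σ : Λ → Fin q) :
    (P.evolve ν t).real (cyl Λ σ) = ∫ η, P.op t (cylFun Λ (Pi.single σ 1)) η ∂ν := by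
  rw [← P.integral_evolve]
  have := integral_cylFun_single (P.evolve ν t) Λ σ fun _ => 1
  simpa using this.symm

theorem sum_mul_integral_genCyl (c : Rates d q) (hc : c.IsContinuous) (ν : Measure (Config d q))
    [IsFiniteMeasure ν] (Λ : Finset (Site d)) (φ : (Λ → Fin q) → ℝ) :
    ∑ σ, φ σ * ∫ η, genCyl c hc Λ (Pi.single σ 1) η ∂ν = ∫ η, genCyl c hc Λ φ η ∂ν := by
  have h : ∀ η, genCyl c hc Λ φ η = ∑ σ, φ σ * genCyl c hc Λ (Pi.single σ 1) η := by
    intro η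
    simp only [genCyl, ContinuousMap.coe_mk, Finset.mul_sum]
    conv_rhs => rw [Finset.sum_comm]
    refine Finset.sum_congr rfl fun x _ => ?_
    conv_rhs => rw [Finset.sum_comm]
    refine Finset.sum_congr rfl fun i _ => ?_
    have h1 : ∀ τ, φ τ = ∑ σ, φ σ * (Pi.single σ 1 : (Λ → Fin q) → ℝ) τ := fun τ => by
      simp [Pi.single_apply]
    rw [h1 (Function.update _ _ _), h1 (Λ.restrict η), ← Finset.sum_sub_distrib, Finset.mul_sum]
    exact Finset.sum_congr rfl fun σ _ => by ring
  rw [integral_congr_ae (ae_of_all _ h), integral_finsetSum]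
  · simp only [integral_const_mul]
  · exact fun σ _ => (integrable_continuousMap ν _).const_mul _

/-- Differentiating `p log (p / m)` gives `p' log (p / m) + p'`. The extra terms `p'` sum to zero
because the generator annihilates constants, and what remains is the generator tested against the
log-density. -/
theorem integral_genCyl_log_eq {c : Rates d q} (hc : c.IsContinuous) {P : MarkovSemigroup d q}
    (hP : P.IsGeneratedBy c) {ν μ : Measure (Config d q)} [IsProbabilityMeasure ν]
    [IsFiniteMeasure μ] {Λ : Finset (Site d)} (hν : ∀ σ : Λ → Fin q, 0 < ν.real (cyl Λ σ))
    (hμ : ∀ σ : Λ → Fin q, 0 < μ.real (cyl Λ σ)) {g : ℝ} (h : HasEntropyLoss P Λ ν μ g) :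
    ∫ η, genCyl c hc Λ
      (fun σ => Real.log (ν.real (cyl Λ σ)) - Real.log (μ.real (cyl Λ σ))) η ∂ν = g := by
  obtain ⟨H, hH, hHd⟩ := h
  set p : (Λ → Fin q) → ℝ → ℝ := fun σ t => (P.evolve ν t.toNNReal).real (cyl Λ σ) with hp
  set D : (Λ → Fin q) → ℝ := fun σ => ∫ η, genCyl c hc Λ (Pi.single σ 1) η ∂ν with hD
  have hpd : ∀ σ, HasDerivWithinAt (p σ) (D σ) (Set.Ici 0) 0 := by
    intro σ
    have := hasDerivWithinAt_integral_op P ν 1 (mem_generator hc hP Λ (Pi.single σ 1))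
    simpa only [hp, hD, P.real_evolve_cyl, ContinuousMap.one_apply, one_mul] using this
  have hp0 : ∀ σ, p σ 0 = ν.real (cyl Λ σ) := by
    intro σ
    simp only [hp, Real.toNNReal_zero, MarkovSemigroup.evolve, P.kernel_zero, Measure.id_comp]
  have hHeq : H =ᶠ[𝓝[≥] 0] fun t => ∑ σ, p σ t * Real.log (p σ t / μ.real (cyl Λ σ)) := by
    filter_upwards [hH] with t ht
    have hac : ∀ σ : Λ → Fin q, μ (cyl Λ σ) = 0 → P.evolve ν t.toNNReal (cyl Λ σ) = 0 := by
      intro σ hσ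
      have := hμ σ
      simp [Measure.real, hσ] at this
    rw [relEntropy, if_pos hac] at ht
    exact (EReal.coe_eq_coe_iff.1 ht).symm
  have hH0 := hHeq.eq_of_nhdsWithin (Set.mem_Ici.2 le_rfl)
  have hterm : ∀ σ, HasDerivWithinAt (fun t => p σ t * Real.log (p σ t / μ.real (cyl Λ σ)))
      (D σ * (Real.log (ν.real (cyl Λ σ)) - Real.log (μ.real (cyl Λ σ))) + D σ)
      (Set.Ici 0) 0 := by
    intro σ
    have h1 := (hpd σ).mul (((hpd σ).div_const (μ.real (cyl Λ σ))).log (by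
      rw [hp0]; exact (div_pos (hν σ) (hμ σ)).ne'))
    refine h1.congr_deriv ?_
    rw [hp0, Real.log_div (hν σ).ne' (hμ σ).ne']
    have := (hν σ).ne'
    have := (hμ σ).ne'
    field_simp
  have hsum : HasDerivWithinAt H (∑ σ, (D σ * (Real.log (ν.real (cyl Λ σ)) -
      Real.log (μ.real (cyl Λ σ))) + D σ)) (Set.Ici 0) 0 :=
    (HasDerivWithinAt.fun_sum fun σ _ => hterm σ).congr_of_eventuallyEq hHeq hH0
  have h1 := (uniqueDiffWithinAt_Ici (0 : ℝ)).eq_deriv _ hHd hsum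
  have h2 := sum_mul_integral_genCyl c hc ν Λ
    (fun σ => Real.log (ν.real (cyl Λ σ)) - Real.log (μ.real (cyl Λ σ)))
  have h3 : ∑ σ, D σ = 0 := by
    have := sum_mul_integral_genCyl c hc ν Λ fun _ => 1
    simp only [one_mul] at this
    rw [this]
    simp [genCyl]
  rw [← h2, h1, Finset.sum_add_distrib, h3, add_zero]
  exact Finset.sum_congr rfl fun σ _ => mul_comm _ _

/-! ### Monotonicity of the defect -/

theorem cyl_inter_cyl {Λ Δ : Finset (Site d)} (h : Λ ⊆ Δ) (σ : Λ → Fin q) (τ : Δ → Fin q) :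
    cyl Δ τ ∩ cyl Λ σ = if Finset.restrict₂ (π := fun _ => Fin q) h τ = σ then cyl Δ τ else ∅ := by
  ext η
  rw [Set.mem_inter_iff, mem_cyl, mem_cyl]
  split_ifs with hτ
  · rw [mem_cyl, and_iff_left_iff_imp]
    rintro rfl
    exact hτ
  · simp only [Set.mem_empty_iff_false, iff_false, not_and]
    rintro rfl h2
    exact hτ h2

theorem setIntegral_cyl_eq_sum (ν : Measure (Config d q)) {Λ Δ : Finset (Site d)} (h : Λ ⊆ Δ)
    (σ : Λ → Fin q) {f : Config d q → ℝ} (hf : Integrable f ν) :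
    ∫ η in cyl Λ σ, f η ∂ν =
      ∑ τ : Δ → Fin q, if Finset.restrict₂ (π := fun _ => Fin q) h τ = σ then
        ∫ η in cyl Δ τ, f η ∂ν else 0 := by
  rw [integral_eq_sum_cyl (ν.restrict (cyl Λ σ)) Δ hf.integrableOn]
  refine Finset.sum_congr rfl fun τ _ => ?_
  rw [Measure.restrict_restrict (measurableSet_cyl Δ τ), cyl_inter_cyl h]
  split_ifs <;> simp

/-- The fluxes in `Λ` are sums of those in `Δ` over the patterns extending a given one, and `(a -
b)² / (a + b)` is subadditive, being convex and homogeneous of degree one. -/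
theorem defect_mono {c : Rates d q} (hc : c.IsContinuous) {δ : ℝ} (hδ : 0 < δ)
    (hcδ : ∀ x η i, δ ≤ c x η i) {ν : Measure (Config d q)} [IsFiniteMeasure ν]
    {Λ Δ : Finset (Site d)} (hν : ∀ σ : Δ → Fin q, 0 < ν.real (cyl Δ σ)) (h : Λ ⊆ Δ) (x : Λ) :
    defect c ν Λ x ≤ defect c ν Δ ⟨x, h x.2⟩ := by
  set y : Δ := ⟨x, h x.2⟩ with hy
  set π : (Δ → Fin q) × Fin q → (Λ → Fin q) × Fin q :=
    fun p => (Finset.restrict₂ (π := fun _ => Fin q) h p.1, p.2) with hπ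
  -- Restriction to `Λ` commutes with reversing a transition, so the reverse fluxes decompose over
  -- the same fibres as the forward ones.
  have hswap : ∀ p, π (swapSpin y p) = swapSpin x (π p) := by
    intro p
    refine Prod.ext ?_ rfl
    ext z
    by_cases hz : z = x
    · subst hz; simp [hπ, swapSpin_apply, hy, Finset.restrict₂]
    · have : (⟨z, h z.2⟩ : Δ) ≠ y := fun h' => hz (Subtype.ext (congrArg Subtype.val h' :))
      simp [hπ, swapSpin_apply, Finset.restrict₂, hz, this]
  have hA : ∀ p : (Λ → Fin q) × Fin q, flux c ν Λ x p.1 p.2 =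
      ∑ p' with π p' = p, flux c ν Δ y p'.1 p'.2 := by
    intro p
    rw [flux, setIntegral_cyl_eq_sum ν h p.1 (integrable_rate hc ν _ _), Finset.sum_filter,
      Fintype.sum_prod_type]
    refine Finset.sum_congr rfl fun τ _ => ?_
    rw [Finset.sum_eq_single p.2]
    · simp [hπ, Prod.ext_iff, flux, hy]
    · intro i _ hi
      exact if_neg fun h' => hi (Prod.ext_iff.1 h').2
    · simp
  have hB : ∀ p : (Λ → Fin q) × Fin q, flux c ν Λ x (Function.update p.1 x p.2) (p.1 x) =
      ∑ p' with π p' = p, flux c ν Δ y (Function.update p'.1 y p'.2) (p'.1 y) := by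
    intro p
    rw [hA (Function.update p.1 x p.2, p.1 x), Finset.sum_filter, Finset.sum_filter,
      ← Equiv.sum_comp (swapSpin y)]
    refine Finset.sum_congr rfl fun p' _ => ?_
    rw [hswap]
    exact if_congr (EmbeddingLike.apply_eq_iff_eq (swapSpin x)) rfl rfl
  calc defect c ν Λ x ≤ ∑ p : (Λ → Fin q) × Fin q, ∑ p' with π p' = p,
        (flux c ν Δ y p'.1 p'.2 - flux c ν Δ y (Function.update p'.1 y p'.2) (p'.1 y)) ^ 2 /
          (flux c ν Δ y p'.1 p'.2 +
            flux c ν Δ y (Function.update p'.1 y p'.2) (p'.1 y)) := by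
        refine Finset.sum_le_sum fun p _ => ?_
        rw [hA p, hB p, ← Finset.sum_sub_distrib, ← Finset.sum_add_distrib]
        exact Finset.sq_sum_div_le_sum_sq_div _ _ fun p' _ => add_pos
          (flux_pos hc hδ hcδ hν y _ _) (flux_pos hc hδ hcδ hν y _ _)
    _ = _ := Finset.sum_fiberwise _ _ _

/-! ### Oscillations -/

theorem glue_insert (s : Finset (Site d)) (z : Site d) (η ξ : Config d q) :
    glue (insert z s) η ξ = Function.update (glue s η ξ) z (η z) := by
  ext y
  by_cases h : y = z
  · subst h; simp [glue]
  · simp [glue, h]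

theorem tendsto_glue (η ξ : Config d q) :
    Tendsto (fun s : Finset (Site d) => glue s η ξ) atTop (𝓝 η) := by
  refine tendsto_pi_nhds.2 fun x => tendsto_const_nhds.congr' ?_
  filter_upwards [eventually_ge_atTop {x}] with s hs
  have : x ∈ s := Finset.singleton_subset_iff.1 hs
  simp [glue, this]

/-- A continuous function varies on a cylinder set at most by the sum of its oscillations outside
of the base of the cylinder. -/
theorem enorm_sub_le_tsum_osc {f : Config d q → ℝ} (hf : Continuous f) {Λ : Finset (Site d)}
    {η ξ : Config d q} (h : ∀ x ∈ Λ, η x = ξ x) :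
    ‖f η - f ξ‖ₑ ≤ ∑' z, if z ∈ Λ then 0 else osc z f := by
  have hfin : ∀ s : Finset (Site d),
      ‖f (glue s η ξ) - f ξ‖ₑ ≤ ∑ z ∈ s, if z ∈ Λ then 0 else osc z f := by
    intro s
    induction s using Finset.induction_on with
    | empty =>
      have : glue ∅ η ξ = ξ := by ext; simp [glue]
      simp [this]
    | insert z s hz ih =>
      rw [Finset.sum_insert hz, glue_insert]
      split_ifs with hzΛ
      · have : Function.update (glue s η ξ) z (η z) = glue s η ξ := by
          rw [Function.update_eq_self_iff, h z hzΛ]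
          simp [glue, hz]
        rwa [this, zero_add]
      · calc ‖f (Function.update (glue s η ξ) z (η z)) - f ξ‖ₑ
            = ‖(f (Function.update (glue s η ξ) z (η z)) - f (glue s η ξ)) +
                (f (glue s η ξ) - f ξ)‖ₑ := by rw [sub_add_sub_cancel]
          _ ≤ _ := (enorm_add_le _ _).trans (add_le_add (le_iSup₂_of_le _ _ le_rfl) ih)
  have hlim : Tendsto (fun s : Finset (Site d) => ‖f (glue s η ξ) - f ξ‖ₑ) atTop
      (𝓝 ‖f η - f ξ‖ₑ) :=
    (((hf.tendsto η).comp (tendsto_glue η ξ)).sub_const _).enorm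
  exact le_of_tendsto hlim (Eventually.of_forall fun s => (hfin s).trans (ENNReal.sum_le_tsum s))

/-! ### Boxes -/

/-- The maximum norm of a site. -/
def level (x : Site d) : ℕ := Finset.univ.sup fun i => (x i).natAbs

/-- The box `[-n, n]^d`. -/
def box (d n : ℕ) : Finset (Site d) := Finset.Icc (fun _ => -(n : ℤ)) fun _ => (n : ℤ)

theorem mem_box {n : ℕ} {x : Site d} : x ∈ box d n ↔ level x ≤ n := by
  simp only [box, Finset.mem_Icc, Pi.le_def, level, Finset.sup_le_iff, Finset.mem_univ,
    forall_const, ← forall_and]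
  exact forall_congr' fun i => by omega

theorem box_mono : Monotone (box d) := fun _ _ h _ hx => mem_box.2 ((mem_box.1 hx).trans h)

theorem level_add_le (x y : Site d) : level (x + y) ≤ level x + level y :=
  Finset.sup_le fun _ hi => (Int.natAbs_add_le _ _).trans <| add_le_add
    (Finset.le_sup (f := fun i => (x i).natAbs) hi) (Finset.le_sup (f := fun i => (y i).natAbs) hi)

theorem level_le_enorm (x : Site d) : (level x : ℝ≥0∞) ≤ ‖x‖ₑ := by
  have h : level x ≤ ⌊‖x‖₊⌋₊ := Finset.sup_le fun _ _ => Nat.le_floor <| by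
    have := nnnorm_le_pi_nnnorm x ‹_›
    rwa [← NNReal.natCast_natAbs] at this
  have h1 : ((level x : ℕ) : ℝ≥0) ≤ ‖x‖₊ := (Nat.le_floor_iff zero_le).1 h
  calc (level x : ℝ≥0∞) = ((level x : ℝ≥0) : ℝ≥0∞) := by simp
    _ ≤ (‖x‖₊ : ℝ≥0∞) := ENNReal.coe_le_coe.2 h1
    _ = ‖x‖ₑ := rfl

theorem card_box (n : ℕ) : (box d n).card = (2 * n + 1) ^ d := by
  rw [box, Pi.card_Icc]
  simp only [Int.card_Icc, Finset.prod_const, Finset.card_univ, Fintype.card_fin]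
  congr 1
  omega

/-- For `d = 2` and `k ≤ n` the count is `(2n + 1)² - (2(n - k) + 1)² ≤ 8k(n + 1)`. This linear
growth in `n` is the only place where the dimension enters. -/
theorem card_boundary_le (hd : d = 1 ∨ d = 2) (n k : ℕ) :
    (((box d n).filter fun x => n < level x + k).card : ℝ) ≤ 8 * k * (n + 1) := by
  have key : ((box d n).filter fun x => n < level x + k).card ≤ 8 * k * (n + 1) := by
    rcases le_or_gt k n with hk | hk
    · obtain ⟨m, rfl⟩ := Nat.exists_eq_add_of_le hk
      have h1 := Finset.card_filter_add_card_filter_not (s := box d (k + m))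
        (fun x => k + m < level x + k)
      have h2 : (box d m).card ≤
          ((box d (k + m)).filter fun x => ¬ k + m < level x + k).card :=
        Finset.card_le_card fun x hx => by
          have := mem_box.1 hx
          exact Finset.mem_filter.2 ⟨mem_box.2 (by omega), by omega⟩
      rw [card_box] at h1 h2
      rcases hd with rfl | rfl <;> nlinarith
    · refine (Finset.card_filter_le _ _).trans ?_
      rw [card_box]
      rcases hd with rfl | rfl <;> nlinarith
  exact_mod_cast key

/-! ### Detailed balance -/

/-- `∑_i sup_x δ_{x+y} (c_x(·, i) 1{η_x ≠ i})` as a real number. -/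
def influence (c : Rates d q) (y : Site d) : ℝ :=
  (∑ i : Fin q, ⨆ x : Site d, osc (x + y) (c.flip x i)).toReal

theorem tsum_level_mul_influence_lt_top {c : Rates d q} (hR4 : c.HasSummableInfluence) :
    ∑' y : Site d, (level y : ℝ≥0∞) * ∑ i : Fin q, ⨆ x : Site d, osc (x + y) (c.flip x i) < ∞ := by
  simp only [Finset.mul_sum]
  rw [Summable.tsum_finsetSum fun _ _ => ENNReal.summable]
  exact ENNReal.sum_lt_top.2 fun i _ => lt_of_le_of_lt
    (ENNReal.tsum_le_tsum fun y => mul_le_mul_left (level_le_enorm y) _) (hR4 i)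

theorem summable_influence {c : Rates d q} (hR4 : c.HasSummableInfluence) :
    Summable fun y => influence c y * level y := by
  refine (ENNReal.summable_toReal (tsum_level_mul_influence_lt_top hR4).ne).congr fun y => ?_
  simp [influence, mul_comm]

theorem Rates.IsContinuous.flip {c : Rates d q} (hc : c.IsContinuous) (x : Site d) (i : Fin q) :
    Continuous (c.flip x i) := by
  have : c.flip x i = fun η => (if i = η x then 0 else 1) * c x η i := by
    ext η; simp [Rates.flip]
  rw [this]
  exact (Continuous.comp (g := fun j : Fin q => if i = j then (0 : ℝ) else 1)
    continuous_of_discreteTopology (continuous_apply x)).mul (hc x i)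

theorem rate_sub_le {c : Rates d q} (hc : c.IsContinuous) (hR4 : c.HasSummableInfluence) (n : ℕ)
    (x : box d n) (τ : box d n → Fin q) (k : Fin q) (hk : k ≠ τ x) (η : Config d q)
    (hη : η ∈ cyl (box d n) τ) (ξ : Config d q) (hξ : ξ ∈ cyl (box d n) τ) :
    c x η k - c x ξ k ≤
      ∑' y, if n < level (x : Site d) + level y then influence c y else 0 := by
  have hx := mem_box.1 x.2
  have hagree : ∀ z ∈ box d n, η z = ξ z := fun z hz => (hη ⟨z, hz⟩).trans (hξ ⟨z, hz⟩).symm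
  have h1 := enorm_sub_le_tsum_osc (hc.flip x k) hagree
  -- As `k` is not the spin at `x` on this cylinder set, the rate of an actual change is the full
  -- rate there.
  simp only [Rates.flip, hη x, hξ x, if_neg hk] at h1
  set G : Site d → ℝ≥0∞ := fun y => if n < level (x : Site d) + level y then
    ∑ i : Fin q, ⨆ x : Site d, osc (x + y) (c.flip x i) else 0 with hG
  have h2 : ∑' z, (if z ∈ box d n then 0 else osc z (c.flip x k)) ≤ ∑' y, G y := by
    rw [← (Equiv.addLeft (x : Site d)).tsum_eq]
    refine ENNReal.tsum_le_tsum fun y => ?_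
    change (if (x : Site d) + y ∈ box d n then (0 : ℝ≥0∞) else
      osc ((x : Site d) + y) (c.flip x k)) ≤ G y
    by_cases h3 : (x : Site d) + y ∈ box d n
    · rw [if_pos h3]
      exact zero_le
    have h4 : n < level (x : Site d) + level y :=
      not_le.1 fun h => h3 (mem_box.2 ((level_add_le _ _).trans h))
    rw [if_neg h3]
    simp only [hG, if_pos h4]
    refine le_trans ?_ (Finset.single_le_sum (fun _ _ => zero_le) (Finset.mem_univ k))
    exact le_iSup (fun z : Site d => osc (z + y) (c.flip z k)) x
  -- Since `level x ≤ n`, a nonzero term has `level y ≥ 1`, so the first moment controls the sum and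
  -- real parts may be taken.
  have h3 : ∑' y, G y ≤ ∑' y : Site d, (level y : ℝ≥0∞) *
      ∑ i : Fin q, ⨆ x : Site d, osc (x + y) (c.flip x i) := by
    refine ENNReal.tsum_le_tsum fun y => ?_
    simp only [hG]
    split_ifs with h4
    · have : (1 : ℝ≥0∞) ≤ level y := by
        exact_mod_cast (by omega : 1 ≤ level y)
      exact le_mul_of_one_le_left' this
    · exact zero_le
  have h4 : ∑' y, G y ≠ ∞ := (h3.trans_lt (tsum_level_mul_influence_lt_top hR4)).ne
  have h5 := ENNReal.toReal_mono h4 (h1.trans h2)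
  rw [ENNReal.tsum_toReal_eq fun y => ENNReal.ne_top_of_tsum_ne_top h4 y] at h5
  rw [toReal_enorm] at h5
  refine (le_abs_self _).trans (h5.trans (le_of_eq (tsum_congr fun y => ?_)))
  simp only [hG, influence]
  split_ifs <;> rfl

theorem Rates.IsUniformlyBounded.exists_le {c : Rates d q} (hR1 : c.IsUniformlyBounded) :
    ∃ K : ℝ, ∀ x η i, c x η i ≤ K := by
  refine ⟨(⨆ x : Site d, ∑ i : Fin q, ⨆ η : Config d q, ‖c x η i‖ₑ).toReal, fun x η i => ?_⟩
  have h : ‖c x η i‖ₑ ≤ ⨆ x : Site d, ∑ i : Fin q, ⨆ η : Config d q, ‖c x η i‖ₑ :=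
    le_iSup_of_le x <| (le_iSup (fun η => ‖c x η i‖ₑ) η).trans <|
      Finset.single_le_sum (f := fun i => ⨆ η : Config d q, ‖c x η i‖ₑ)
        (fun _ _ => zero_le) (Finset.mem_univ i)
  have h1 := ENNReal.toReal_mono hR1.ne h
  rw [toReal_enorm] at h1
  exact (le_abs_self _).trans h1

/-- In dimensions one and two, a fully supported measure without entropy loss with respect to a
reversible measure satisfies the detailed balance equations. -/
theorem isBalanced_of_hasEntropyLoss_zero (hd : d = 1 ∨ d = 2) {c : Rates d q}
    (hR1 : c.IsUniformlyBounded) (hc : c.IsContinuous) (hR3 : c.IsBoundedBelow)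
    (hR4 : c.HasSummableInfluence) {P : MarkovSemigroup d q} (hP : P.IsGeneratedBy c)
    {μ : Measure (Config d q)} [IsProbabilityMeasure μ] (hμ : P.IsReversible μ)
    {ν : Measure (Config d q)} [IsProbabilityMeasure ν]
    (hν : ∀ (Λ : Finset (Site d)) (σ : Λ → Fin q), 0 < ν.real (cyl Λ σ))
    (hg : ∀ Λ : Finset (Site d), HasEntropyLoss P Λ ν μ 0) (n : ℕ) :
    IsBalanced c ν (box d n) := by
  obtain ⟨K, hK⟩ := hR1.exists_le
  have hb := fun Λ => hμ.isBalanced hc hP Λ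
  have hμpos : ∀ (Λ : Finset (Site d)) (σ : Λ → Fin q), 0 < μ.real (cyl Λ σ) :=
    fun Λ σ => (hb Λ).real_cyl_pos hc hR3 σ
  obtain ⟨δ, hδ, hcδ⟩ := hR3
  have hdef0 : ∀ (Λ : Finset (Site d)) (x : Λ), 0 ≤ defect c ν Λ x := fun Λ x =>
    Finset.sum_nonneg fun p _ => div_nonneg (sq_nonneg _)
      (add_pos (flux_pos hc hδ hcδ (hν Λ) x _ _) (flux_pos hc hδ hcδ (hν Λ) x _ _)).le
  -- The value `0` off the box keeps `α` increasing in `n`: a site enters with a nonnegative defect.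
  set α : ℕ → Site d → ℝ := fun n x =>
    if h : x ∈ box d n then defect c ν (box d n) ⟨x, h⟩ else 0 with hα
  have hα0 : ∀ n x, 0 ≤ α n x := by
    intro n x
    simp only [hα]
    split_ifs
    exacts [hdef0 _ _, le_rfl]
  have hαm : ∀ x, Monotone fun n => α n x := by
    intro x m n hmn
    by_cases h : x ∈ box d m
    · simp only [hα, dif_pos h, dif_pos (box_mono hmn h)]
      exact defect_mono hc hδ hcδ (hν _) (box_mono hmn) ⟨x, h⟩
    · simpa only [hα, dif_neg h] using hα0 n x
  have hinf0 : ∀ y, 0 ≤ influence c y := fun y => ENNReal.toReal_nonneg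
  have H : ∀ n, ∑ x ∈ box d n, α n x ≤ (2 / δ * √(2 * (q * K))) * ∑ x ∈ box d n,
      (∑' y, if n < level x + level y then influence c y else 0) * √(α n x) := by
    intro n
    have := sum_defect_le hc hδ hcδ (hν (box d n)) (hμpos _) (hb _) (fun _ => rfl)
      (integral_genCyl_log_eq hc hP (hν _) (hμpos _) (hg (box d n)))
      (r := fun x => ∑' y, if n < level (x : Site d) + level y then influence c y else 0)
      (fun x => tsum_nonneg fun y => by
        split_ifs
        exacts [hinf0 y, le_rfl])
      (rate_sub_le hc hR4 n) hK
    rw [← Finset.sum_coe_sort (box d n), ← Finset.sum_coe_sort (box d n)]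
    simpa only [hα, Finset.coe_mem, dite_true] using this
  have hzero := eq_zero_of_boundary_estimate (box d) level (fun n x => mem_box)
    (by norm_num) (card_boundary_le hd) (influence c) hinf0 level (summable_influence hR4)
    α hα0 hαm H
  refine isBalanced_of_defect_eq_zero hc hδ hcδ (hν _) fun x => ?_
  have := hzero n x x.2
  simpa only [hα, Finset.coe_mem, dite_true] using this

/-! ### Detailed balance for general test functions -/

theorem measurable_finsetRestrict (Λ : Finset (Site d)) :
    Measurable (Λ.restrict : Config d q → (Λ → Fin q)) :=
  measurable_pi_iff.2 fun x => measurable_pi_apply (x : Site d)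

theorem measurable_updateAt (x : Site d) (j : Fin q) :
    Measurable fun η : Config d q => Function.update η x j := by
  refine measurable_pi_iff.2 fun y => ?_
  by_cases h : y = x
  · subst h; simp
  · simpa [h] using measurable_pi_apply y

theorem measurableSet_spin (x : Site d) (j : Fin q) :
    MeasurableSet {η : Config d q | η x = j} :=
  (measurable_pi_apply (X := fun _ : Site d => Fin q) x) (measurableSet_singleton j)

theorem setLIntegral_cyl_ofReal {c : Rates d q} (hc : c.IsContinuous) {δ : ℝ} (hδ : 0 < δ)
    (hcδ : ∀ x η i, δ ≤ c x η i) (ν : Measure (Config d q)) [IsFiniteMeasure ν]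
    {Λ : Finset (Site d)} (x : Λ) (σ : Λ → Fin q) (i : Fin q) :
    ∫⁻ η in cyl Λ σ, ENNReal.ofReal (c x η i) ∂ν = ENNReal.ofReal (flux c ν Λ x σ i) :=
  (ofReal_integral_eq_lintegral_ofReal (integrable_rate hc ν x i).integrableOn
    (ae_of_all _ fun η => hδ.le.trans (hcδ x η i))).symm

/-- Detailed balance in all boxes as an identity of measures. -/
theorem map_withDensity_eq {c : Rates d q} (hc : c.IsContinuous) {δ : ℝ} (hδ : 0 < δ)
    (hcδ : ∀ x η i, δ ≤ c x η i) {ν : Measure (Config d q)} [IsFiniteMeasure ν]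
    (h : ∀ n, IsBalanced c ν (box d n)) (x : Site d) (i j : Fin q) :
    (((ν.restrict {η | η x = i}).withDensity fun η => ENNReal.ofReal (c x η j)).map
      fun η => Function.update η x j) =
    (ν.restrict {η | η x = j}).withDensity fun η => ENNReal.ofReal (c x η i) := by
  set m₁ := ((ν.restrict {η | η x = i}).withDensity fun η => ENNReal.ofReal (c x η j)).map
    fun η => Function.update η x j with hm₁
  set m₂ := (ν.restrict {η | η x = j}).withDensity fun η => ENNReal.ofReal (c x η i) with hm₂
  have : IsFiniteMeasure m₂ := isFiniteMeasure_withDensity_ofReal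
    (integrable_rate hc _ x i).hasFiniteIntegral
  have hbox : ∀ n, level x ≤ n → m₁.map (box d n).restrict = m₂.map (box d n).restrict := by
    intro n hn
    refine Measure.ext_of_singleton fun σ => ?_
    set y : box d n := ⟨x, mem_box.2 hn⟩ with hy
    rw [Measure.map_apply (measurable_finsetRestrict _) (measurableSet_singleton σ),
      Measure.map_apply (measurable_finsetRestrict _) (measurableSet_singleton σ), ← cyl_eq_preimage,
      hm₁, hm₂, Measure.map_apply (measurable_updateAt x j) (measurableSet_cyl _ σ),
      withDensity_apply _ (measurableSet_cyl _ σ),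
      withDensity_apply _ (measurable_updateAt x j (measurableSet_cyl _ σ)),
      Measure.restrict_restrict (measurableSet_cyl _ σ),
      Measure.restrict_restrict (measurable_updateAt x j (measurableSet_cyl _ σ))]
    by_cases hσ : σ y = j
    · have h1 : cyl (box d n) σ ∩ {η | η x = j} = cyl (box d n) σ :=
        Set.inter_eq_left.2 fun η hη => (hη y).trans hσ
      have h2 : (fun η : Config d q => Function.update η x j) ⁻¹' cyl (box d n) σ ∩
          {η | η x = i} = cyl (box d n) (Function.update σ y i) := by
        ext η
        rw [Set.mem_inter_iff, Set.mem_preimage, mem_cyl, mem_cyl]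
        have h3 : (box d n).restrict (Function.update η x j) =
          Function.update ((box d n).restrict η) y j := restrict_update η y j
        rw [h3]
        constructor
        · rintro ⟨h4, h5⟩
          have h5 : (box d n).restrict η y = i := h5
          rw [← h4, Function.update_idem, ← h5, Function.update_eq_self]
        · intro h4
          refine ⟨?_, ?_⟩
          · rw [h4, Function.update_idem, ← hσ, Function.update_eq_self]
          · have := congrFun h4 y
            simpa using this
      rw [h1, h2]
      have h3 := h n y σ i
      rw [hσ] at h3
      have h4 := setLIntegral_cyl_ofReal hc hδ hcδ ν y σ i
      have h5 := setLIntegral_cyl_ofReal hc hδ hcδ ν y (Function.update σ y i) j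
      rw [← h3, ← h4] at h5
      exact h5
    · have h1 : cyl (box d n) σ ∩ {η | η x = j} = ∅ :=
        Set.eq_empty_of_forall_notMem fun η hη => hσ ((hη.1 y).symm.trans hη.2)
      have h2 : (fun η : Config d q => Function.update η x j) ⁻¹' cyl (box d n) σ ∩
          {η | η x = i} = ∅ :=
        Set.eq_empty_of_forall_notMem fun η hη => hσ (by
          have := hη.1 y
          simpa [hy] using this.symm)
      rw [h1, h2]
      simp
  -- Every finite set lies in a box that also contains `x`, and a finite measure is determined by
  -- its finite-dimensional marginals.
  have hall : ∀ I : Finset (Site d), m₁.map I.restrict = m₂.map I.restrict := by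
    intro I
    set n := max (level x) (I.sup level) with hn
    have hI : I ⊆ box d n := fun z hz =>
      mem_box.2 ((Finset.le_sup (f := level) hz).trans (le_max_right _ _))
    have hcomp : (I.restrict : Config d q → (I → Fin q)) =
        Finset.restrict₂ (π := fun _ => Fin q) hI ∘ (box d n).restrict := rfl
    have hm : Measurable (Finset.restrict₂ (π := fun _ => Fin q) hI) := measurable_of_finite _
    rw [hcomp, ← Measure.map_map hm (measurable_finsetRestrict _),
      ← Measure.map_map hm (measurable_finsetRestrict _), hbox n (le_max_left _ _)]
  exact IsProjectiveLimit.unique (P := fun I => m₂.map I.restrict) (fun I => hall I) fun I => rfl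

theorem setIntegral_spin_eq {c : Rates d q} (hc : c.IsContinuous) {δ : ℝ} (hδ : 0 < δ)
    (hcδ : ∀ x η i, δ ≤ c x η i) {ν : Measure (Config d q)} [IsFiniteMeasure ν]
    (h : ∀ n, IsBalanced c ν (box d n)) (x : Site d) (i j : Fin q) {f : Config d q → ℝ}
    (hf : Measurable f) :
    ∫ η in {η | η x = j}, c x η i * f η ∂ν =
      ∫ η in {η | η x = i}, c x η j * f (Function.update η x j) ∂ν := by
  have hmeas : ∀ k, Measurable fun η => ENNReal.ofReal (c x η k) := fun k =>
    (hc x k).measurable.ennreal_ofReal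
  have h1 := congrArg (fun m => ∫ η, f η ∂m) (map_withDensity_eq hc hδ hcδ h x i j)
  rw [integral_map (measurable_updateAt x j).aemeasurable hf.aestronglyMeasurable,
    integral_withDensity_eq_integral_toReal_smul (hmeas j) (ae_of_all _ fun _ => by finiteness),
    integral_withDensity_eq_integral_toReal_smul (hmeas i)
      (ae_of_all _ fun _ => by finiteness)] at h1
  simpa only [smul_eq_mul, ENNReal.toReal_ofReal (hδ.le.trans (hcδ x _ _))] using h1.symm

/-- Detailed balance on a cylinder set with a test function that does not depend on the spin
at `x`. -/
theorem setIntegral_cyl_eq {c : Rates d q} (hc : c.IsContinuous) {δ : ℝ} (hδ : 0 < δ)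
    (hcδ : ∀ x η i, δ ≤ c x η i) {ν : Measure (Config d q)} [IsFiniteMeasure ν]
    (h : ∀ n, IsBalanced c ν (box d n)) {Λ : Finset (Site d)} (x : Λ) (σ : Λ → Fin q)
    (i : Fin q) {f : Config d q → ℝ} (hf : Measurable f)
    (hfx : ∀ η j, f (Function.update η x j) = f η) :
    ∫ η in cyl Λ σ, c x η i * f η ∂ν =
      ∫ η in cyl Λ (Function.update σ x i), c x η (σ x) * f η ∂ν := by
  have h1 := setIntegral_spin_eq hc hδ hcδ h x i (σ x)
    (hf.indicator (measurableSet_cyl Λ σ))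
  have h2 : cyl Λ σ ⊆ {η | η x = σ x} := fun η hη => hη x
  have h3 : cyl Λ (Function.update σ x i) ⊆ {η | η x = i} := fun η hη => by simpa using hη x
  have e1 : ∀ η, c x η i * (cyl Λ σ).indicator f η =
      (cyl Λ σ).indicator (fun η => c x η i * f η) η := fun η =>
    by
    by_cases hη : η ∈ cyl Λ σ <;> simp [hη]
  have e2 : ∀ η ∈ {η : Config d q | η x = i},
      c x η (σ x) * (cyl Λ σ).indicator f (Function.update η x (σ x)) =
      (cyl Λ (Function.update σ x i)).indicator (fun η => c x η (σ x) * f η) η := by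
    intro η hη
    have : Function.update η (x : Site d) (σ x) ∈ cyl Λ σ ↔
        η ∈ cyl Λ (Function.update σ x i) := by
      rw [mem_cyl, mem_cyl, restrict_update]
      have hη' : Λ.restrict η x = i := hη
      constructor
      · intro h4
        rw [← h4, Function.update_idem, ← hη', Function.update_eq_self]
      · intro h4
        rw [h4, Function.update_idem, Function.update_eq_self]
    by_cases hm : η ∈ cyl Λ (Function.update σ x i)
    · rw [Set.indicator_of_mem hm, Set.indicator_of_mem (this.2 hm), hfx]
    · rw [Set.indicator_of_notMem hm, Set.indicator_of_notMem (fun h' => hm (this.1 h')),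
        mul_zero]
  rw [setIntegral_congr_fun (measurableSet_spin _ _) e2] at h1
  simp only [e1] at h1
  rw [setIntegral_indicator (measurableSet_cyl _ _), setIntegral_indicator (measurableSet_cyl _ _),
    Set.inter_eq_right.2 h2, Set.inter_eq_right.2 h3] at h1
  exact h1

/-! ### Functions of the configuration outside of a finite set -/

/-- The configuration that is `σ` on `Λ` and `η` off `Λ`. -/
def fill (Λ : Finset (Site d)) (σ : Λ → Fin q) (η : Config d q) : Config d q :=
  fun y => if h : y ∈ Λ then σ ⟨y, h⟩ else η y

/-- The σ-algebra `𝓕_{Λᶜ}`. -/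
abbrev outer (q : ℕ) (Λ : Finset (Site d)) : MeasurableSpace (Config d q) :=
  cylinderEvents (X := fun _ : Site d => Fin q) ((Λ : Set (Site d))ᶜ)

theorem outer_le (Λ : Finset (Site d)) : outer q Λ ≤ MeasurableSpace.pi := cylinderEvents_le_pi

theorem fill_mem_cyl (Λ : Finset (Site d)) (σ : Λ → Fin q) (η : Config d q) :
    fill Λ σ η ∈ cyl Λ σ := fun x => by simp [fill]

theorem fill_eq_self {Λ : Finset (Site d)} {σ : Λ → Fin q} {η : Config d q}
    (h : η ∈ cyl Λ σ) : fill Λ σ η = η := by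
  ext y
  by_cases hy : y ∈ Λ
  · simp [fill, hy, h ⟨y, hy⟩]
  · simp [fill, hy]

theorem continuous_fill (Λ : Finset (Site d)) (σ : Λ → Fin q) : Continuous (fill Λ σ) := by
  refine continuous_pi fun y => ?_
  by_cases hy : y ∈ Λ
  · simpa [fill, hy] using continuous_const
  · simpa [fill, hy] using continuous_apply y

theorem measurable_fill (Λ : Finset (Site d)) (σ : Λ → Fin q) :
    Measurable[outer q Λ, MeasurableSpace.pi] (fill Λ σ) := by
  refine @measurable_pi_lambda _ _ _ (outer q Λ) _ _ fun y => ?_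
  by_cases hy : y ∈ Λ
  · simp [fill, hy]
  · simpa [fill, hy] using measurable_cylinderEvent_apply (X := fun _ : Site d => Fin q)
      (Δ := ((Λ : Set (Site d))ᶜ)) (i := y) (by simpa using hy)

/-- The σ-algebra of `Δ` is contained in the pullback under restriction to `Δ`, and measurable maps
into a space with measurable singletons factor through the restriction. -/
theorem dependsOn_of_measurable {Z : Type*} [MeasurableSpace Z] [MeasurableSingletonClass Z]
    {Δ : Set (Site d)} {f : Config d q → Z}
    (hf : Measurable[cylinderEvents (X := fun _ : Site d => Fin q) Δ] f) : DependsOn f Δ := by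
  have hle : cylinderEvents (X := fun _ : Site d => Fin q) Δ ≤
      MeasurableSpace.comap (Set.domRestrict Δ) MeasurableSpace.pi :=
    iSup₂_le fun i hi => by
      have h := (measurable_pi_apply (X := fun _ : Δ => Fin q) ⟨i, hi⟩).comap_le
      have h1 := MeasurableSpace.comap_mono (g := Set.domRestrict (π := fun _ => Fin q) Δ) h
      rwa [MeasurableSpace.comap_comp] at h1
  exact dependsOn_iff_factorsThrough.2 (hf.mono hle le_rfl).factorsThrough

theorem apply_fill_of_measurable {Z : Type*} [MeasurableSpace Z] [MeasurableSingletonClass Z]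
    {Λ : Finset (Site d)} {f : Config d q → Z} (hf : Measurable[outer q Λ] f) (σ : Λ → Fin q)
    (η : Config d q) : f (fill Λ σ η) = f η :=
  dependsOn_of_measurable hf fun y hy => by
    have : y ∉ Λ := by simpa using hy
    simp [fill, this]

theorem apply_update_of_measurable {Z : Type*} [MeasurableSpace Z] [MeasurableSingletonClass Z]
    {Λ : Finset (Site d)} {f : Config d q → Z} (hf : Measurable[outer q Λ] f) (x : Λ)
    (η : Config d q) (j : Fin q) : f (Function.update η x j) = f η :=
  dependsOn_of_measurable hf fun y hy => by
    have : y ≠ x := fun h => hy (by simp [h])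
    simp [this]

/-! ### The finite-volume densities of a specification -/

namespace Specification

variable (γ : Specification d q)

/-- The conditional probability `γ_Λ(σ | η_{Λᶜ})`. -/
def density (Λ : Finset (Site d)) (σ : Λ → Fin q) (η : Config d q) : ℝ :=
  (γ.kernel Λ η).real (cyl Λ σ)

theorem measurable_density (Λ : Finset (Site d)) (σ : Λ → Fin q) :
    Measurable[outer q Λ] (γ.density Λ σ) :=
  @Measurable.ennreal_toReal _ (outer q Λ) _
    (@Kernel.measurable_coe _ _ (outer q Λ) _ (γ.kernel Λ) _ (measurableSet_cyl Λ σ))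

theorem density_nonneg (Λ : Finset (Site d)) (σ : Λ → Fin q) (η : Config d q) :
    0 ≤ γ.density Λ σ η := measureReal_nonneg

theorem density_le_one (Λ : Finset (Site d)) (σ : Λ → Fin q) (η : Config d q) :
    γ.density Λ σ η ≤ 1 := by
  have := γ.isProbabilityMeasure Λ η
  exact measureReal_le_one

theorem sum_density (Λ : Finset (Site d)) (η : Config d q) : ∑ σ, γ.density Λ σ η = 1 := by
  have := γ.isProbabilityMeasure Λ η
  exact sum_real_cyl (γ.kernel Λ η) Λ

theorem condProb_fill (Λ : Finset (Site d)) (σ : Λ → Fin q) (η ω : Config d q) :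
    γ.condProb Λ (fill Λ σ η) ω = γ.density Λ σ ω := by
  rw [condProb, density, mem_cyl.1 (fill_mem_cyl Λ σ η)]

theorem IsQuasilocal.continuous_density {γ : Specification d q} (h : γ.IsQuasilocal)
    (Λ : Finset (Site d)) (σ : Λ → Fin q) : Continuous (γ.density Λ σ) := by
  rw [continuous_iff_continuousAt]
  intro η
  rw [ContinuousAt, Metric.tendsto_nhds]
  intro ε hε
  obtain ⟨Δ, hΔ⟩ := ((ENNReal.tendsto_nhds_zero.1 (h Λ)) (ENNReal.ofReal (ε / 2))
    (by simpa using hε)).exists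
  have hmem : cyl Δ (Δ.restrict η) ∈ 𝓝 η :=
    (isClopen_cyl _ _).isOpen.mem_nhds (mem_cyl.2 rfl)
  filter_upwards [hmem] with ξ hξ
  -- Both configurations are filled with `σ` on `Λ`, so the event is `[σ]` on both sides and the
  -- glued boundary condition is `ξ` itself, off `Λ`.
  have h1 := (le_iSup₂ (f := fun η ξ => ‖γ.condProb Λ η (glue Δ η ξ) - γ.condProb Λ η η‖ₑ)
    (fill Λ σ η) (fill Λ σ ξ)).trans hΔ
  have h2 : glue Δ (fill Λ σ η) (fill Λ σ ξ) = fill Λ σ ξ := by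
    ext y
    by_cases hy : y ∈ Δ
    · have := hξ ⟨y, hy⟩
      simp only [Finset.restrict] at this
      simp [glue, hy, fill, this]
    · simp [glue, hy]
  rw [h2, γ.condProb_fill, γ.condProb_fill, apply_fill_of_measurable (γ.measurable_density Λ σ),
    apply_fill_of_measurable (γ.measurable_density Λ σ), ← ofReal_norm,
    ENNReal.ofReal_le_ofReal_iff (by positivity)] at h1
  rw [dist_eq_norm]
  linarith

theorem kernel_inter_cyl (Λ : Finset (Site d)) (σ : Λ → Fin q) {B : Set (Config d q)}
    (hB : MeasurableSet[outer q Λ] B) (ω : Config d q) :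
    γ.kernel Λ ω (cyl Λ σ ∩ B) = B.indicator 1 ω * γ.kernel Λ ω (cyl Λ σ) :=
  (γ.isProper Λ).inter_eq_indicator_mul (outer_le Λ) (measurableSet_cyl Λ σ) hB ω

theorem ofReal_density (Λ : Finset (Site d)) (σ : Λ → Fin q) (η : Config d q) :
    ENNReal.ofReal (γ.density Λ σ η) = γ.kernel Λ η (cyl Λ σ) := by
  have := γ.isProbabilityMeasure Λ η
  exact ofReal_measureReal

/-- The DLR equation for a Gibbs measure, tested against a function of the configuration
off `Λ`. -/
theorem setIntegral_cyl_of_mem_gibbsMeasures {γ : Specification d q} {μ : Measure (Config d q)}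
    (hμ : μ ∈ γ.gibbsMeasures) {Λ : Finset (Site d)} (σ : Λ → Fin q) {f : Config d q → ℝ}
    (hf : Measurable[outer q Λ] f) :
    ∫ η in cyl Λ σ, f η ∂μ = ∫ η, γ.density Λ σ η * f η ∂μ := by
  have hdm : Measurable fun η => ENNReal.ofReal (γ.density Λ σ η) :=
    ((γ.measurable_density Λ σ).mono (outer_le Λ) le_rfl).ennreal_ofReal
  -- The two measures agree only on `𝓕_{Λᶜ}`, where properness pulls the indicator out of the
  -- kernel.
  have htrim : (μ.restrict (cyl Λ σ)).trim (outer_le Λ) =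
      (μ.withDensity fun η => ENNReal.ofReal (γ.density Λ σ η)).trim (outer_le Λ) := by
    refine @Measure.ext _ (outer q Λ) _ _ fun B hB => ?_
    rw [trim_measurableSet_eq _ hB, trim_measurableSet_eq _ hB,
      Measure.restrict_apply (outer_le Λ _ hB), withDensity_apply _ (outer_le Λ _ hB),
      Set.inter_comm, ← hμ.2 Λ _ ((measurableSet_cyl Λ σ).inter (outer_le Λ _ hB)),
      ← lintegral_indicator (outer_le Λ _ hB)]
    refine lintegral_congr fun ω => ?_
    rw [γ.kernel_inter_cyl Λ σ hB]
    by_cases hω : ω ∈ B <;> simp [hω, γ.ofReal_density]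
  have hfs : StronglyMeasurable[outer q Λ] f := hf.stronglyMeasurable
  rw [integral_trim (outer_le Λ) hfs, htrim, ← integral_trim (outer_le Λ) hfs,
    integral_withDensity_eq_integral_toReal_smul hdm (ae_of_all _ fun _ => by finiteness)]
  simp only [smul_eq_mul, ENNReal.toReal_ofReal (γ.density_nonneg Λ σ _)]

end Specification

/-! ### Detailed balance and Gibbs measures -/

theorem isOpenPosMeasure_of_real_cyl_pos {μ : Measure (Config d q)}
    (h : ∀ (Λ : Finset (Site d)) (σ : Λ → Fin q), 0 < μ.real (cyl Λ σ)) :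
    μ.IsOpenPosMeasure := by
  refine ⟨fun U hU ⟨η, hη⟩ h0 => ?_⟩
  obtain ⟨I, u, hu, hsub⟩ := isOpen_pi_iff.1 hU η hη
  have hcyl : cyl I (I.restrict η) ⊆ U := fun ξ hξ => hsub fun y hy => by
    have : ξ y = η y := hξ ⟨y, hy⟩
    rw [this]
    exact (hu y hy).2
  have := h I (I.restrict η)
  rw [measureReal_def, measure_mono_null hcyl h0] at this
  simp at this

/-- The densities of the specification of a Gibbs measure with detailed balance satisfy the
detailed balance equations pointwise. -/
theorem rate_mul_density_eq {c : Rates d q} (hc : c.IsContinuous) {δ : ℝ} (hδ : 0 < δ)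
    (hcδ : ∀ x η i, δ ≤ c x η i) {γ : Specification d q} (hγ : γ.IsQuasilocal)
    {μ : Measure (Config d q)} [IsFiniteMeasure μ] (hμ : μ ∈ γ.gibbsMeasures)
    (hpos : ∀ (Λ : Finset (Site d)) (σ : Λ → Fin q), 0 < μ.real (cyl Λ σ))
    (h : ∀ n, IsBalanced c μ (box d n)) {Λ : Finset (Site d)} (x : Λ) (σ : Λ → Fin q)
    (i : Fin q) (η : Config d q) :
    c x (fill Λ σ η) i * γ.density Λ σ η =
      c x (fill Λ (Function.update σ x i) η) (σ x) * γ.density Λ (Function.update σ x i) η := by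
  set τ := Function.update σ x i with hτ
  have hu : ∀ (ρ : Λ → Fin q) k, Measurable[outer q Λ] fun η => c x (fill Λ ρ η) k := fun ρ k =>
    (hc x k).measurable.comp (measurable_fill Λ ρ)
  have huc : ∀ (ρ : Λ → Fin q) k, Continuous fun η => c x (fill Λ ρ η) k := fun ρ k =>
    (hc x k).comp (continuous_fill Λ ρ)
  -- The test function is the defect of the claimed identity itself. It does not depend on the spins
  -- in `Λ`, so balance and the DLR equation give `∫ f² dμ = 0`; continuity and full support then
  -- give `f = 0` everywhere.
  set f : Config d q → ℝ := fun η => c x (fill Λ σ η) i * γ.density Λ σ η -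
    c x (fill Λ τ η) (σ x) * γ.density Λ τ η with hf
  have hfm : Measurable[outer q Λ] f := Measurable.sub
    (Measurable.mul (hu σ i) (γ.measurable_density Λ σ))
    (Measurable.mul (hu τ (σ x)) (γ.measurable_density Λ τ))
  have hfc : Continuous f := ((huc σ i).mul (hγ.continuous_density Λ σ)).sub
    ((huc τ (σ x)).mul (hγ.continuous_density Λ τ))
  have key : ∀ (ρ : Λ → Fin q) k, ∫ η, γ.density Λ ρ η * (c x (fill Λ ρ η) k * f η) ∂μ =
      ∫ η in cyl Λ ρ, c x η k * f η ∂μ := by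
    intro ρ k
    refine (Specification.setIntegral_cyl_of_mem_gibbsMeasures hμ ρ
      ((hu ρ k).mul hfm)).symm.trans ?_
    refine setIntegral_congr_fun (measurableSet_cyl Λ ρ) fun η hη => ?_
    simp only [Pi.mul_apply, fill_eq_self hη]
  have hInt : ∀ (ρ : Λ → Fin q) k,
      Integrable (fun η => γ.density Λ ρ η * (c x (fill Λ ρ η) k * f η)) μ := fun ρ k =>
    integrable_continuousMap μ ⟨_, (hγ.continuous_density Λ ρ).mul ((huc ρ k).mul hfc)⟩
  have h1 := setIntegral_cyl_eq hc hδ hcδ h x σ i (hfm.mono (outer_le Λ) le_rfl)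
    (apply_update_of_measurable hfm x)
  rw [← key, ← key, ← sub_eq_zero, ← integral_sub (hInt _ _) (hInt _ _)] at h1
  have h2 : ∫ η, f η ^ 2 ∂μ = 0 := by
    rw [← h1]
    refine integral_congr_ae (ae_of_all _ fun η => ?_)
    simp only [hf]
    ring
  have := isOpenPosMeasure_of_real_cyl_pos hpos
  have h3 := (Continuous.ae_eq_iff_eq μ (hfc.pow 2) continuous_zero).1
    ((integral_eq_zero_iff_of_nonneg (fun η => sq_nonneg (f η))
      (integrable_continuousMap μ ⟨_, hfc.pow 2⟩)).1 h2)
  exact sub_eq_zero.1 ((pow_eq_zero_iff two_ne_zero).1 (congrFun h3 η))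

/-- Some density is positive as they sum to one, and the balance equations propagate positivity
along single-spin changes. -/
theorem density_pos {c : Rates d q} {δ : ℝ} (hδ : 0 < δ) (hcδ : ∀ x η i, δ ≤ c x η i)
    {γ : Specification d q} {Λ : Finset (Site d)} {η : Config d q}
    (h : ∀ (x : Λ) (σ : Λ → Fin q) (i : Fin q), c x (fill Λ σ η) i * γ.density Λ σ η =
      c x (fill Λ (Function.update σ x i) η) (σ x) * γ.density Λ (Function.update σ x i) η)
    (σ : Λ → Fin q) : 0 < γ.density Λ σ η := by
  obtain ⟨τ, hτ⟩ : ∃ τ, 0 < γ.density Λ τ η := by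
    by_contra! hn
    have := Finset.sum_nonpos fun σ (_ : σ ∈ Finset.univ) => hn σ
    rw [γ.sum_density] at this
    linarith
  refine forall_of_forall_update (p := fun σ => 0 < γ.density Λ σ η) (fun σ x i hσ => ?_) hτ σ
  have h1 : 0 < c x (fill Λ σ η) i * γ.density Λ σ η := mul_pos (hδ.trans_le (hcδ _ _ _)) hσ
  rw [h] at h1
  exact pos_of_mul_pos_right h1 (hδ.le.trans (hcδ _ _ _))

/-- A measure with detailed balance satisfies the DLR equations of a specification whose densities
satisfy the detailed balance equations. -/
theorem mem_gibbsMeasures_of_isBalanced {c : Rates d q} (hc : c.IsContinuous) {δ : ℝ}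
    (hδ : 0 < δ) (hcδ : ∀ x η i, δ ≤ c x η i) {γ : Specification d q}
    (hγ : ∀ (Λ : Finset (Site d)) (x : Λ) (σ : Λ → Fin q) (i : Fin q) (η : Config d q),
      c x (fill Λ σ η) i * γ.density Λ σ η =
      c x (fill Λ (Function.update σ x i) η) (σ x) * γ.density Λ (Function.update σ x i) η)
    {ν : Measure (Config d q)} [IsProbabilityMeasure ν]
    (h : ∀ n, IsBalanced c ν (box d n)) : ν ∈ γ.gibbsMeasures := by
  refine ⟨inferInstance, fun Λ A hA => ?_⟩
  have hpos : ∀ σ η, 0 < γ.density Λ σ η := fun σ η =>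
    density_pos hδ hcδ (fun x σ i => hγ Λ x σ i η) σ
  have hcm : ∀ (x : Λ) (ρ : Λ → Fin q) k, Measurable[outer q Λ] fun η => c x (fill Λ ρ η) k :=
    fun x ρ k => (hc x k).measurable.comp (measurable_fill Λ ρ)
  -- For `f` depending only on the outside of `Λ`, the integral of `f / γ_Λ(τ)` over `[τ]` does not
  -- depend on `τ`. For one spin change, divide by either side of the balance equation for the
  -- densities and use the balance of `ν`.
  have hstep : ∀ (f : Config d q → ℝ), Measurable[outer q Λ] f → ∀ (σ τ : Λ → Fin q),
      ∫ η in cyl Λ τ, f η / γ.density Λ τ η ∂ν = ∫ η in cyl Λ σ, f η / γ.density Λ σ η ∂ν := by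
    intro f hf σ
    refine forall_of_forall_update (p := fun τ => ∫ η in cyl Λ τ, f η / γ.density Λ τ η ∂ν =
      ∫ η in cyl Λ σ, f η / γ.density Λ σ η ∂ν) (fun τ x i hτ => ?_) rfl
    rw [← hτ]
    set g : Config d q → ℝ := fun η => f η / (c x (fill Λ τ η) i * γ.density Λ τ η) with hg
    have hgm : Measurable[outer q Λ] g := Measurable.div hf
      (Measurable.mul (hcm x τ i) (γ.measurable_density Λ τ))
    have h1 := setIntegral_cyl_eq hc hδ hcδ h x τ i (hgm.mono (outer_le Λ) le_rfl)
      (apply_update_of_measurable hgm x)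
    have e1 : ∫ η in cyl Λ τ, c x η i * g η ∂ν = ∫ η in cyl Λ τ, f η / γ.density Λ τ η ∂ν := by
      refine setIntegral_congr_fun (measurableSet_cyl Λ τ) fun η hη => ?_
      have := (hδ.trans_le (hcδ x η i)).ne'
      have := (hpos τ η).ne'
      simp only [hg, fill_eq_self hη]
      field_simp
    have e2 : ∫ η in cyl Λ (Function.update τ x i), c x η (τ x) * g η ∂ν =
        ∫ η in cyl Λ (Function.update τ x i), f η / γ.density Λ (Function.update τ x i) η ∂ν := by
      refine setIntegral_congr_fun (measurableSet_cyl Λ _) fun η hη => ?_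
      have := (hδ.trans_le (hcδ x η (τ x))).ne'
      have := (hpos (Function.update τ x i) η).ne'
      simp only [hg, hγ Λ x τ i η, fill_eq_self hη]
      field_simp
    rw [← e1, ← e2, h1]
  have hind : ∀ B : Set (Config d q), MeasurableSet[outer q Λ] B →
      Measurable[outer q Λ] (B.indicator (1 : Config d q → ℝ)) := fun B hB =>
    Measurable.indicator measurable_const hB
  have hInt : ∀ B : Set (Config d q), MeasurableSet[outer q Λ] B → ∀ τ : Λ → Fin q,
      Integrable (fun η => B.indicator 1 η * γ.density Λ τ η) ν := by
    intro B hB τ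
    refine Integrable.of_bound (((hind B hB).mono (outer_le Λ) le_rfl).mul
      ((γ.measurable_density Λ τ).mono (outer_le Λ) le_rfl)).aestronglyMeasurable 1
      (ae_of_all _ fun η => ?_)
    by_cases hη : η ∈ B
    · simpa [hη, abs_of_nonneg (γ.density_nonneg Λ τ η)] using γ.density_le_one Λ τ η
    · simp [hη]
  have hDLR : ∀ (B : Set (Config d q)), MeasurableSet[outer q Λ] B → ∀ σ : Λ → Fin q,
      ∫ η, B.indicator 1 η * γ.density Λ σ η ∂ν = ν.real (cyl Λ σ ∩ B) := by
    intro B hB σ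
    have hBm : MeasurableSet B := outer_le Λ _ hB
    have h1m := hind B hB
    have hInt' := hInt B hB
    calc ∫ η, B.indicator 1 η * γ.density Λ σ η ∂ν
        = ∑ τ, ∫ η in cyl Λ τ, B.indicator 1 η * γ.density Λ σ η ∂ν :=
          integral_eq_sum_cyl ν Λ (hInt' σ)
      _ = ∑ τ, ∫ η in cyl Λ σ, B.indicator 1 η * γ.density Λ τ η ∂ν := by
          refine Finset.sum_congr rfl fun τ _ => ?_
          -- With this choice of `f`, the integral of `1_B γ_Λ(σ)` over `[τ]` becomes that of `1_B
          -- γ_Λ(τ)` over `[σ]`, and the densities then sum to one over `τ`.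
          have := hstep (fun η => B.indicator 1 η * γ.density Λ σ η * γ.density Λ τ η)
            (Measurable.mul (Measurable.mul
              h1m (γ.measurable_density Λ σ)) (γ.measurable_density Λ τ)) σ τ
          have e1 : ∀ η, B.indicator 1 η * γ.density Λ σ η * γ.density Λ τ η /
              γ.density Λ τ η = B.indicator 1 η * γ.density Λ σ η := fun η =>
            mul_div_cancel_right₀ _ (hpos τ η).ne'
          have e2 : ∀ η, B.indicator 1 η * γ.density Λ σ η * γ.density Λ τ η /
              γ.density Λ σ η = B.indicator 1 η * γ.density Λ τ η := fun η => by
            rw [mul_right_comm, mul_div_cancel_right₀ _ (hpos σ η).ne']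
          simpa only [e1, e2] using this
      _ = ∫ η in cyl Λ σ, B.indicator 1 η ∂ν := by
          rw [← integral_finsetSum _ fun τ _ => (hInt' τ).integrableOn]
          simp only [← Finset.mul_sum, γ.sum_density, mul_one]
      _ = ν.real (cyl Λ σ ∩ B) := by
          rw [integral_indicator_one hBm, measureReal_restrict_apply hBm, Set.inter_comm]
  have hB : ∀ σ : Λ → Fin q, MeasurableSet[outer q Λ] (fill Λ σ ⁻¹' A) := fun σ =>
    measurable_fill Λ σ hA
  -- On `[σ]` any event coincides with an event of `𝓕_{Λᶜ}`, so it is enough to know `ν` on such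
  -- intersections.
  have hcap : ∀ σ : Λ → Fin q, A ∩ cyl Λ σ = cyl Λ σ ∩ fill Λ σ ⁻¹' A := by
    intro σ
    ext η
    simp only [Set.mem_inter_iff, Set.mem_preimage]
    constructor
    · rintro ⟨h1, h2⟩
      exact ⟨h2, by rwa [fill_eq_self h2]⟩
    · rintro ⟨h1, h2⟩
      exact ⟨by rwa [fill_eq_self h1] at h2, h1⟩
  have hsplit : ∀ m : Measure (Config d q), m A = ∑ σ : Λ → Fin q, m (cyl Λ σ ∩ fill Λ σ ⁻¹' A) := by
    intro m
    have hU : A = ⋃ σ : Λ → Fin q, A ∩ cyl Λ σ := by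
      rw [← Set.inter_iUnion, eq_comm, Set.inter_eq_left]
      exact fun η _ => Set.mem_iUnion.2 ⟨Λ.restrict η, mem_cyl.2 rfl⟩
    conv_lhs => rw [hU]
    rw [measure_iUnion (fun σ τ hστ => Set.disjoint_left.2 fun η h1 h2 =>
      hστ ((mem_cyl.1 h1.2).symm.trans (mem_cyl.1 h2.2)))
      fun σ => hA.inter (measurableSet_cyl Λ σ), tsum_fintype]
    simp only [hcap]
  simp only [hsplit]
  rw [lintegral_finsetSum']
  · refine Finset.sum_congr rfl fun σ _ => ?_
    have h1 := hDLR _ (hB σ) σ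
    rw [← ofReal_measureReal (μ := ν) (s := cyl Λ σ ∩ fill Λ σ ⁻¹' A), ← h1,
      ofReal_integral_eq_lintegral_ofReal]
    · refine lintegral_congr fun η => ?_
      rw [γ.kernel_inter_cyl Λ σ (hB σ), ← γ.ofReal_density]
      by_cases hη : η ∈ fill Λ σ ⁻¹' A <;> simp [hη]
    · exact hInt _ (hB σ) σ
    · exact ae_of_all _ fun η => mul_nonneg (Set.indicator_nonneg (fun _ _ => zero_le_one) η)
        (γ.density_nonneg Λ σ η)
  · exact fun σ _ => (Measurable.mono (@Kernel.measurable_coe _ _ (outer q Λ) _ (γ.kernel Λ) _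
      ((measurableSet_cyl Λ σ).inter (outer_le Λ _ (hB σ)))) (outer_le Λ) le_rfl).aemeasurable

end IPS

end

theorem mainTheorem4 (d q : ℕ) (hd : d = 1 ∨ d = 2)
    (c : IPS.Rates d q)
    (hR1 : c.IsUniformlyBounded)
    (hR2 : c.IsContinuous)
    (hR3 : c.IsBoundedBelow)
    (hR4 : c.HasSummableInfluence)
    (P : IPS.MarkovSemigroup d q) (hP : P.IsGeneratedBy c)
    (γ : IPS.Specification d q)
    (hS1 : γ.IsQuasilocal)
    (hS2 : γ.IsNonNull)
    (hS3 : γ.HasSummableInfluence)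
    (μ : MeasureTheory.Measure (IPS.Config d q))
    (hμ_rev : P.IsReversible μ)
    (hμ_gibbs : μ ∈ γ.gibbsMeasures)
    (ν : MeasureTheory.Measure (IPS.Config d q)) [MeasureTheory.IsProbabilityMeasure ν]
    (hM1 : ∀ (η : IPS.Config d q) (Λ : Finset (IPS.Site d)), 0 < ν (IPS.cyl Λ (Λ.restrict η)))
    (hM2 : ∀ Λ : Finset (IPS.Site d), IPS.HasEntropyLoss P Λ ν μ 0) :
    ν ∈ γ.gibbsMeasures := by
  have : MeasureTheory.IsProbabilityMeasure μ := hμ_gibbs.1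
  have hμ_bal := fun Λ => hμ_rev.isBalanced hR2 hP Λ
  have hμ_pos := fun Λ σ => (hμ_bal Λ).real_cyl_pos hR2 hR3 σ
  have hν_pos : ∀ (Λ : Finset (IPS.Site d)) (σ : Λ → Fin q), 0 < ν.real (IPS.cyl Λ σ) := by
    intro Λ σ
    -- The pattern must extend to a configuration; positive mass under `μ` provides one.
    obtain ⟨η, hη⟩ := IPS.cyl_nonempty_of_real_pos (hμ_pos Λ σ)
    have := hM1 η Λ
    rw [IPS.mem_cyl.1 hη] at this
    exact ENNReal.toReal_pos this.ne' (MeasureTheory.measure_ne_top _ _)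
  have hν_bal := IPS.isBalanced_of_hasEntropyLoss_zero hd hR1 hR2 hR3 hR4 hP hμ_rev hν_pos hM2
  obtain ⟨δ, hδ, hcδ⟩ := hR3
  exact IPS.mem_gibbsMeasures_of_isBalanced hR2 hδ hcδ
    (fun Λ x σ i η => IPS.rate_mul_density_eq hR2 hδ hcδ hS1 hμ_gibbs hμ_pos
      (fun n => hμ_bal (IPS.box d n)) x σ i η) hν_bal
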